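/- **Diagrams.** Let $\mathbb C$ be the category generated by the following graph and relations. Objects: $\star$ (channel); $[n]$ for $n\in\mathbb N$ (player knowing $n$ channels); the basic moves $\heartsuit_n$ (tick), $\pi^l_n,\pi^r_n$ (left and right half-forking), $\nu_n$ (name creation), and, for $0\le i<n$, $\iota^+_{n,i}$ (output) and $\iota^-_{n,i}$ (input); $\pi_n$ (forking); and $\tau_{n,i,m,j}$ (synchronisation) for $0\le i<n$, $0\le j<m$. Generators: $d_i:\star\to[n]$ for $0\le i<n$; $s,t:[n]\to\beta$ for each basic move $\beta$ with index $n$, except that $t:[n+1]\to\nu_n$; $l:\pi^l_n\to\pi_n$, $r:\pi^r_n\to\pi_n$; $\epsilon:\iota^+_{n,i}\to\tau_{n,i,m,j}$, $\rho:\iota^-_{m,j}\to\tau_{n,i,m,j}$. Relations: $s d_i=t d_i$ for $0\le i<n$, $ls=rs$, and $\epsilon s d_i=\rho s d_j$. A *diagram* is a presheaf of sets on $\mathbb C$. A *position* is a diagram with countably many elements, all of them over $\star$ or over some $[n]$. **Plays.** Each move object $\mu$ determines a cospan $X_0\hookrightarrow\mu\hookleftarrow Y_0$, where $\mu$ denotes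 the representable diagram, and $X_0$ (resp. $Y_0$) consists of the initial (resp. final) players of $\mu$, i.e. those obtained through an $s$ (resp. a $t$), with the channels they know. An *extended move* $X\to M\leftarrow Y$ is obtained from such a cospan by glueing a position $Z$ along the channels of $X_0$ (i.e. $X,M,Y$ are the pushouts of $X_0,\mu,Y_0$ with $Z$ over these channels, along an arbitrary map from them to $Z$). A *play* is a map of diagrams $X\hookrightarrow U$, with $X$ a position, isomorphic to a finite or $\omega$-indexed composition of extended moves in the bicategory of cospans of diagrams, $U$ being the colimit of the resulting zigzag; it is *finite* if it is a finite such composition. A *view* is a finite composition of basic moves (not extended), starting from the position $[n]$ for some $n$. A play $X\hookrightarrow U$ is *closed-world* if every element of $U$ over an $\iota^+_{n,i}$ or an $\iota^-_{m,j}$ is the restriction, along $\epsilon$ or $\rho$ respectively, of an element over some $\tau_{n,i,m,j}$. **Strategies.** For a position $X$, let $\mathbb E_X$ be the category whose objects are plays $Y\hookrightarrow U$ with an injection $Y\hookrightarrow X$, and whose morphisms are the pairs of injections $(h:Y\hookrightarrow Y',\,k:U\hookrightarrow U')$ commuting with these data. Let $\mathbb V_X$ be its full subcategory of views, with inclusion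 $i_X$. Let $\mathbb W(X)$ be the category of closed-world plays with base $X$, with the injections that are the identity on $X$ as morphisms, and let $j_X:\mathbb W(X)\to\mathbb E_X$ be the inclusion. An *innocent strategy* on $X$ is a presheaf of sets $F$ on $\mathbb V_X$, and $\mathrm{Gl}(F)=j_X^*\,\mathrm{Ran}_{i_X^{op}}(F)$ is the presheaf on $\mathbb W(X)$ obtained from $F$ by right Kan extension to $\mathbb E_X$ and restriction to $\mathbb W(X)$. Given $\sigma\in\mathrm{Gl}(F)(U)$, an *extension* of $\sigma$ consists of a morphism $i:U\to U'$ of $\mathbb W(X)$ and $\sigma'\in\mathrm{Gl}(F)(U')$ with $\mathrm{Gl}(F)(i)(\sigma')=\sigma$; it is *strict* if $i$ is not surjective. A state is *$\mathrm{Gl}(F)$-maximal* if it has no strict extension. **Theorem.** Let $X$ be a position and $F$ an innocent strategy on $X$. For every finite closed-world play $U\in\mathbb W(X)$, every state $\sigma\in\mathrm{Gl}(F)(U)$ admits a $\mathrm{Gl}(F)$-maximal extension. -/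

import Mathlib

open CategoryTheory CategoryTheory.Limits Opposite

universe w

namespace CCS

/-! ### The base category -/

/-- Names of basic moves: tick, left and right half-forking, name creation, output on the `i`-th
channel and input on the `i`-th channel, for a player knowing `n` channels. -/
inductive Basic : Type
  | tick (n : ℕ) : Basic
  | parL (n : ℕ) : Basic
  | parR (n : ℕ) : Basic
  | nu (n : ℕ) : Basic
  | out (n : ℕ) (i : Fin n) : Basic
  | inp (n : ℕ) (i : Fin n) : Basic

/-- Number of channels known to the player before the basic move. -/
def Basic.src : Basic → ℕ
  | tick n => n
  | parL n => n
  | parR n => n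
  | nu n => n
  | out n _ => n
  | inp n _ => n

/-- Number of channels known to the player after the basic move. -/
def Basic.tgt : Basic → ℕ
  | tick n => n
  | parL n => n
  | parR n => n
  | nu n => n + 1
  | out n _ => n
  | inp n _ => n

theorem Basic.src_le_tgt (b : Basic) : b.src ≤ b.tgt := by
  cases b <;> simp [Basic.src, Basic.tgt]

/-- All moves: the basic ones, (full) forking, and synchronisation between a sender knowing `n`
channels, on its `i`-th channel, and a receiver knowing `m` channels, on its `j`-th channel. -/
inductive Move : Type
  | basic (b : Basic) : Move
  | fork (n : ℕ) : Move
  | sync (n : ℕ) (i : Fin n) (m : ℕ) (j : Fin m) : Move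

/-- Objects of the base category. -/
inductive Obj : Type
  | chan : Obj
  | player (n : ℕ) : Obj
  | move (μ : Move) : Obj

open Move Obj

/-- Morphisms of the base category, in normal form.  The category is generated by
* `d_i = knows i : chan ⟶ player n`, for `i < n`,
* `s = src b : player b.src ⟶ b` and `t = tgt b : player b.tgt ⟶ b`, for `b` a basic move,
* `l = forkL n : parL n ⟶ fork n` and `r = forkR n : parR n ⟶ fork n`,
* `ε = syncOut : out n i ⟶ sync n i m j` and `ρ = syncInp : inp m j ⟶ sync n i m j`,

subject to `s ∘ d_i = t ∘ d_i` (for `i < b.src`), `l ∘ s = r ∘ s`, and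
`ε ∘ s ∘ d_i = ρ ∘ s ∘ d_j`.  The other constructors are the remaining composites:
* `name b i = t ∘ d_i`,
* `forkSrc = l ∘ s = r ∘ s`, `forkTgtL = l ∘ t`, `forkTgtR = r ∘ t`, `forkName i = l ∘ t ∘ d_i`,
* `outSrc = ε ∘ s`, `outTgt = ε ∘ t`, `inpSrc = ρ ∘ s`, `inpTgt = ρ ∘ t`,
  `outName k = ε ∘ t ∘ d_k`, and `inpName k = ρ ∘ t ∘ d_k` for `k ≠ j`. -/
inductive Hom : Obj → Obj → Type
  | id (c : Obj) : Hom c c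
  | knows {n : ℕ} (i : Fin n) : Hom chan (player n)
  | src {k : ℕ} (b : Basic) (h : k = b.src) : Hom (player k) (move (basic b))
  | tgt {k : ℕ} (b : Basic) (h : k = b.tgt) : Hom (player k) (move (basic b))
  | name (b : Basic) (i : Fin b.tgt) : Hom chan (move (basic b))
  | forkL (n : ℕ) : Hom (move (basic (.parL n))) (move (fork n))
  | forkR (n : ℕ) : Hom (move (basic (.parR n))) (move (fork n))
  | forkSrc {k n : ℕ} (h : k = n) : Hom (player k) (move (fork n))
  | forkTgtL {k n : ℕ} (h : k = n) : Hom (player k) (move (fork n))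
  | forkTgtR {k n : ℕ} (h : k = n) : Hom (player k) (move (fork n))
  | forkName {n : ℕ} (i : Fin n) : Hom chan (move (fork n))
  | syncOut {n : ℕ} (i : Fin n) {m : ℕ} (j : Fin m) :
      Hom (move (basic (.out n i))) (move (sync n i m j))
  | syncInp {n : ℕ} (i : Fin n) {m : ℕ} (j : Fin m) :
      Hom (move (basic (.inp m j))) (move (sync n i m j))
  | outSrc {k n : ℕ} (h : k = n) (i : Fin n) {m : ℕ} (j : Fin m) :
      Hom (player k) (move (sync n i m j))
  | outTgt {k n : ℕ} (h : k = n) (i : Fin n) {m : ℕ} (j : Fin m) :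
      Hom (player k) (move (sync n i m j))
  | inpSrc {k n : ℕ} (i : Fin n) {m : ℕ} (h : k = m) (j : Fin m) :
      Hom (player k) (move (sync n i m j))
  | inpTgt {k n : ℕ} (i : Fin n) {m : ℕ} (h : k = m) (j : Fin m) :
      Hom (player k) (move (sync n i m j))
  | outName {n : ℕ} (i : Fin n) {m : ℕ} (j : Fin m) (k : Fin n) :
      Hom chan (move (sync n i m j))
  | inpName {n : ℕ} (i : Fin n) {m : ℕ} (j : Fin m) (k : Fin m) (h : k ≠ j) :
      Hom chan (move (sync n i m j))

/-- The composite `ρ ∘ t ∘ d_k`, for an arbitrary `k < m`. -/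
def Hom.inpName' {n : ℕ} (i : Fin n) {m : ℕ} (j : Fin m) (k : Fin m) :
    Hom chan (move (sync n i m j)) :=
  if h : k = j then .outName i j i else .inpName i j k h

/-- Composition, in diagrammatic order. -/
def Hom.comp : {c d e : Obj} → Hom c d → Hom d e → Hom c e
  | _, _, _, .id _, g => g
  | _, _, _, f, .id _ => f
  | _, _, _, .knows i, .src b h => .name b (i.castLE (h.trans_le b.src_le_tgt))
  | _, _, _, .knows i, .tgt b h => .name b (i.cast h)
  | _, _, _, .knows i, .forkSrc h => .forkName (i.cast h)
  | _, _, _, .knows i, .forkTgtL h => .forkName (i.cast h)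
  | _, _, _, .knows i, .forkTgtR h => .forkName (i.cast h)
  | _, _, _, .knows k, .outSrc h i j => .outName i j (k.cast h)
  | _, _, _, .knows k, .outTgt h i j => .outName i j (k.cast h)
  | _, _, _, .knows k, .inpSrc i h j => .inpName' i j (k.cast h)
  | _, _, _, .knows k, .inpTgt i h j => .inpName' i j (k.cast h)
  | _, _, _, .src (.parL _) h, .forkL _ => .forkSrc h
  | _, _, _, .tgt (.parL _) h, .forkL _ => .forkTgtL h
  | _, _, _, .name (.parL _) k, .forkL _ => .forkName k
  | _, _, _, .src (.parR _) h, .forkR _ => .forkSrc h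
  | _, _, _, .tgt (.parR _) h, .forkR _ => .forkTgtR h
  | _, _, _, .name (.parR _) k, .forkR _ => .forkName k
  | _, _, _, .src (.out _ i) h, .syncOut _ j => .outSrc h i j
  | _, _, _, .tgt (.out _ i) h, .syncOut _ j => .outTgt h i j
  | _, _, _, .name (.out _ i) k, .syncOut _ j => .outName i j k
  | _, _, _, .src (.inp _ j) h, .syncInp i _ => .inpSrc i h j
  | _, _, _, .tgt (.inp _ j) h, .syncInp i _ => .inpTgt i h j
  | _, _, _, .name (.inp _ j) k, .syncInp i _ => .inpName' i j k

theorem Hom.comp_id {c d : Obj} (f : Hom c d) : f.comp (.id d) = f := by cases f <;> rfl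

instance : Category Obj where
  Hom := Hom
  id := Hom.id
  comp := Hom.comp
  id_comp f := by cases f <;> rfl
  comp_id := Hom.comp_id
  assoc f g h := by cases f <;> cases g <;> cases h <;> first | rfl | simp only [Hom.comp_id]

/-- Diagrams are presheaves of sets on the base category. -/
abbrev Diagram : Type 1 := Objᵒᵖ ⥤ Type

/-- The restriction of an element of a diagram along a morphism of the base category. -/
def res {U : Diagram} {c d : Obj} (f : c ⟶ d) (x : U.obj (op d)) : U.obj (op c) := U.map f.op x

/-! ### Positions and moves -/

/-- Positions are the (countable) diagrams which contain only channels and players. -/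
structure IsPosition (X : Diagram) : Prop where
  noMove : ∀ μ : Move, IsEmpty (X.obj (op (move μ)))
  countable : ∀ c : Obj, Countable (X.obj (op c))

/-- The position consisting of one player knowing `n` distinct channels. -/
abbrev single (n : ℕ) : Diagram := yoneda.obj (player n)

/-- The diagram representing a move. -/
abbrev Move.diagram (μ : Move) : Diagram := yoneda.obj (move μ)

/-- Players of the initial position of a move. -/
inductive IsInitial : {n : ℕ} → {μ : Move} → (player n ⟶ move μ) → Prop
  | src {k : ℕ} (b : Basic) (h : k = b.src) : IsInitial (Hom.src b h)
  | forkSrc {k n : ℕ} (h : k = n) : IsInitial (Hom.forkSrc h)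
  | outSrc {k n : ℕ} (h : k = n) (i : Fin n) {m : ℕ} (j : Fin m) : IsInitial (Hom.outSrc h i j)
  | inpSrc {k n : ℕ} (i : Fin n) {m : ℕ} (h : k = m) (j : Fin m) : IsInitial (Hom.inpSrc i h j)

/-- Players of the final position of a move. -/
inductive IsFinal : {n : ℕ} → {μ : Move} → (player n ⟶ move μ) → Prop
  | tgt {k : ℕ} (b : Basic) (h : k = b.tgt) : IsFinal (Hom.tgt b h)
  | forkTgtL {k n : ℕ} (h : k = n) : IsFinal (Hom.forkTgtL h)
  | forkTgtR {k n : ℕ} (h : k = n) : IsFinal (Hom.forkTgtR h)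
  | outTgt {k n : ℕ} (h : k = n) (i : Fin n) {m : ℕ} (j : Fin m) : IsFinal (Hom.outTgt h i j)
  | inpTgt {k n : ℕ} (i : Fin n) {m : ℕ} (h : k = m) (j : Fin m) : IsFinal (Hom.inpTgt i h j)

/-- The subdiagram of a move made of the players satisfying `S` and of the channels they know. -/
def Move.span (μ : Move) (S : ∀ {n : ℕ}, (player n ⟶ move μ) → Prop) :
    Subfunctor μ.diagram where
  obj c := {f | ∃ (n : ℕ) (p : player n ⟶ move μ) (g : unop c ⟶ player n), S p ∧ f = g ≫ p}
  map := by
    rintro c d i f ⟨n, p, g, hp, rfl⟩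
    exact ⟨n, p, i.unop ≫ g, hp, by simp⟩

/-- The initial position of a move. -/
def Move.initial (μ : Move) : Subfunctor μ.diagram := μ.span IsInitial

/-- The final position of a move. -/
def Move.final (μ : Move) : Subfunctor μ.diagram := μ.span IsFinal

/-- The channels of the initial position of a move, which are exactly what it shares with the
final position. -/
def Move.interface (μ : Move) : Subfunctor μ.diagram := μ.initial ⊓ μ.final

/-- Extended moves: cospans `X ⟶ M ⟵ Y` obtained from the cospan `X₀ ⟶ M₀ ⟵ Y₀` of a move by
glueing a position `Z` along the channels of `X₀`. -/
def IsExtendedMove {X M Y : Diagram} (a : X ⟶ M) (b : Y ⟶ M) : Prop :=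
  ∃ (μ : Move) (Z : Diagram) (f : μ.interface.toFunctor ⟶ Z)
    (x₀ : μ.initial.toFunctor ⟶ X) (x₁ : Z ⟶ X)
    (m₀ : μ.diagram ⟶ M) (m₁ : Z ⟶ M)
    (y₀ : μ.final.toFunctor ⟶ Y) (y₁ : Z ⟶ Y),
    IsPosition Z ∧
    IsPushout (Subfunctor.homOfLe (inf_le_left : μ.interface ≤ μ.initial)) f x₀ x₁ ∧
    IsPushout μ.interface.ι f m₀ m₁ ∧
    IsPushout (Subfunctor.homOfLe (inf_le_right : μ.interface ≤ μ.final)) f y₀ y₁ ∧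
    x₀ ≫ a = μ.initial.ι ≫ m₀ ∧ x₁ ≫ a = m₁ ∧
    y₀ ≫ b = μ.final.ι ≫ m₀ ∧ y₁ ≫ b = m₁

/-- Basic moves, not extended: cospans isomorphic to `X₀ ⟶ M₀ ⟵ Y₀`, for a basic move. -/
def IsBasicMove {X M Y : Diagram} (a : X ⟶ M) (b : Y ⟶ M) : Prop :=
  ∃ (β : Basic) (x : (basic β).initial.toFunctor ≅ X) (m : (basic β).diagram ≅ M)
    (y : (basic β).final.toFunctor ≅ Y),
    x.hom ≫ a = (basic β).initial.ι ≫ m.hom ∧ y.hom ≫ b = (basic β).final.ι ≫ m.hom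

/-- Identity cospans, up to isomorphism. -/
def IsIdle {X M Y : Diagram} (a : X ⟶ M) (b : Y ⟶ M) : Prop := IsIso a ∧ IsIso b

/-! ### Plays and views -/

/-- A presentation of `u : P ⟶ U` as the composition of an infinite sequence of cospans
`X n ⟶ M n ⟵ X (n + 1)`: `P` is isomorphic to `X 0` and `U` is the colimit of the zigzag.
Finite compositions are included, because identity cospans will be allowed in the sequence. -/
structure Composition {P U : Diagram} (u : P ⟶ U) where
  X : ℕ → Diagram
  M : ℕ → Diagram
  a : ∀ n, X n ⟶ M n
  b : ∀ n, X (n + 1) ⟶ M n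
  m : ∀ n, M n ⟶ U
  start : P ≅ X 0
  fac : start.hom ≫ a 0 ≫ m 0 = u
  glue : ∀ n, b n ≫ m n = a (n + 1) ≫ m (n + 1)
  desc : ∀ (T : Diagram) (t : ∀ n, M n ⟶ T), (∀ n, b n ≫ t n = a (n + 1) ≫ t (n + 1)) →
    ∃! v : U ⟶ T, ∀ n, m n ≫ v = t n

/-- All cospans of the sequence are extended moves or identities. -/
def Composition.OfMoves {P U : Diagram} {u : P ⟶ U} (c : Composition u) : Prop :=
  ∀ n, IsExtendedMove (c.a n) (c.b n) ∨ IsIdle (c.a n) (c.b n)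

/-- All cospans of the sequence are basic moves or identities. -/
def Composition.OfBasicMoves {P U : Diagram} {u : P ⟶ U} (c : Composition u) : Prop :=
  ∀ n, IsBasicMove (c.a n) (c.b n) ∨ IsIdle (c.a n) (c.b n)

/-- All but finitely many cospans of the sequence are identities. -/
def Composition.Finite {P U : Diagram} {u : P ⟶ U} (c : Composition u) : Prop :=
  ∃ N, ∀ n, N ≤ n → IsIdle (c.a n) (c.b n)

/-- Plays: finite or infinite compositions of extended moves. -/
def IsPlay {P U : Diagram} (u : P ⟶ U) : Prop :=
  IsPosition P ∧ ∃ c : Composition u, c.OfMoves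

/-- Finite plays: finite compositions of extended moves. -/
def IsFinitePlay {P U : Diagram} (u : P ⟶ U) : Prop :=
  IsPosition P ∧ ∃ c : Composition u, c.OfMoves ∧ c.Finite

/-- Views: finite compositions of basic moves, starting from a single player. -/
def IsView {P U : Diagram} (u : P ⟶ U) : Prop :=
  (∃ n, Nonempty (single n ≅ P)) ∧ ∃ c : Composition u, c.OfBasicMoves ∧ c.Finite

/-- Closed-world diagrams: all outputs and inputs are part of a synchronisation. -/
structure IsClosedWorld (U : Diagram) : Prop where
  out : ∀ (n : ℕ) (i : Fin n) (x : U.obj (op (move (basic (.out n i))))),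
    ∃ (m : ℕ) (j : Fin m) (y : U.obj (op (move (sync n i m j)))), res (Hom.syncOut i j) y = x
  inp : ∀ (m : ℕ) (j : Fin m) (x : U.obj (op (move (basic (.inp m j))))),
    ∃ (n : ℕ) (i : Fin n) (y : U.obj (op (move (sync n i m j)))), res (Hom.syncInp i j) y = x

/-! ### Categories of plays over a position -/

/-- Objects of the category of plays on `X`: plays `base ⟶ total` with an injection of their
initial position into `X`. -/
structure PlayOn (X : Diagram) where
  base : Diagram
  total : Diagram
  emb : base ⟶ total
  isPlay : IsPlay emb
  incl : base ⟶ X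
  mono_incl : Mono incl

/-- Morphisms of plays on `X`: pairs of injections `(h, k)` making the obvious diagram commute. -/
@[ext]
structure PlayOn.Hom {X : Diagram} (U V : PlayOn X) where
  h : U.base ⟶ V.base
  k : U.total ⟶ V.total
  mono_h : Mono h
  mono_k : Mono k
  square : h ≫ V.emb = U.emb ≫ k
  triangle : h ≫ V.incl = U.incl

instance (X : Diagram) : Category (PlayOn X) where
  Hom := PlayOn.Hom
  id U := ⟨𝟙 _, 𝟙 _, inferInstance, inferInstance, by simp, by simp⟩
  comp f g := ⟨f.h ≫ g.h, f.k ≫ g.k,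
    have := f.mono_h; have := g.mono_h; mono_comp _ _,
    have := f.mono_k; have := g.mono_k; mono_comp _ _,
    by rw [Category.assoc, g.square, ← Category.assoc, f.square, Category.assoc],
    by rw [Category.assoc, g.triangle, f.triangle]⟩
  id_comp f := by apply PlayOn.Hom.ext <;> simp
  comp_id f := by apply PlayOn.Hom.ext <;> simp
  assoc f g h := by apply PlayOn.Hom.ext <;> simp

/-- The views on `X`, among plays on `X`. -/
def isViewOn (X : Diagram) : ObjectProperty (PlayOn X) := fun U => IsView U.emb

/-- The category of views on `X`, a full subcategory of plays on `X`. -/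
abbrev ViewOn (X : Diagram) := (isViewOn X).FullSubcategory

/-- Objects of the category of closed-world plays with base `X`. -/
structure ClosedPlay (X : Diagram) where
  total : Diagram
  emb : X ⟶ total
  isPlay : IsPlay emb
  closed : IsClosedWorld total

/-- Morphisms of closed-world plays with base `X`: injections which are the identity on `X`. -/
@[ext]
structure ClosedPlay.Hom {X : Diagram} (U V : ClosedPlay X) where
  k : U.total ⟶ V.total
  mono_k : Mono k
  triangle : U.emb ≫ k = V.emb

instance (X : Diagram) : Category (ClosedPlay X) where
  Hom := ClosedPlay.Hom
  id U := ⟨𝟙 _, inferInstance, by simp⟩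
  comp f g := ⟨f.k ≫ g.k, have := f.mono_k; have := g.mono_k; mono_comp _ _,
    by rw [← Category.assoc, f.triangle, g.triangle]⟩
  id_comp f := by apply ClosedPlay.Hom.ext; simp
  comp_id f := by apply ClosedPlay.Hom.ext; simp
  assoc f g h := by apply ClosedPlay.Hom.ext; simp

/-- The inclusion of closed-world plays with base `X` into plays on `X`. -/
def ClosedPlay.incl (X : Diagram) : ClosedPlay X ⥤ PlayOn X where
  obj U := ⟨X, U.total, U.emb, U.isPlay, 𝟙 X, inferInstance⟩
  map f := ⟨𝟙 X, f.k, inferInstance, f.mono_k, by simp [f.triangle], by simp⟩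
  map_id _ := rfl
  map_comp _ _ := PlayOn.Hom.ext (Category.comp_id _).symm rfl

/-! ### Strategies, behaviours and states -/

/-- Innocent strategies on `X` are presheaves on views. -/
abbrev Strategy (X : Diagram) := (ViewOn X)ᵒᵖ ⥤ Type w

/-- Closed-world behaviours on `X` are presheaves on closed-world plays. -/
abbrev Behaviour (X : Diagram) := (ClosedPlay X)ᵒᵖ ⥤ Type w

/-- The global behaviour of an innocent strategy: its right Kan extension to plays, restricted to
closed-world plays.  (The universe lift only ensures that the required limits exist.) -/
noncomputable def Gl {X : Diagram} (F : Strategy.{w} X) : Behaviour.{max 1 w} X :=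
  (ClosedPlay.incl X).op ⋙
    (isViewOn X).ι.op.pointwiseRightKanExtension (F ⋙ uliftFunctor.{1, w})

/-- A closed-world play is finite when it consists of finitely many moves. -/
def ClosedPlay.IsFinite {X : Diagram} (U : ClosedPlay X) : Prop := IsFinitePlay U.emb

/-- `σ'` is an extension of `σ`, along the morphism `i`. -/
def IsExtension {X : Diagram} (G : Behaviour.{w} X) {U U' : ClosedPlay X} (i : U ⟶ U')
    (σ : G.obj (op U)) (σ' : G.obj (op U')) : Prop :=
  G.map i.op σ' = σ

/-- An extension along `i` is strict when `i` is not surjective. -/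
def IsStrict {X : Diagram} {U U' : ClosedPlay X} (i : U ⟶ U') : Prop :=
  ¬ ∀ c : Obj, Function.Surjective (ClosedPlay.Hom.k i |>.app (op c))

/-- A state is `G`-maximal when it has no strict extension. -/
def IsMaximalState {X : Diagram} (G : Behaviour.{w} X) {U : ClosedPlay X} (σ : G.obj (op U)) :
    Prop :=
  ∀ (U' : ClosedPlay X) (i : U ⟶ U') (σ' : G.obj (op U')), IsExtension G i σ σ' → ¬ IsStrict i

end CCS

/-!
The theorem follows from a description of closed-world plays that does not mention any order in
which their moves are made.  A map `u : X ⟶ U` is *causal* (`IsCausal`) when it is injective, every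
element of `U` outside `X` is created by exactly one event, every player is consumed by at most one
event, and every element is reached from `X` by finitely many moves.  For closed-world `U` over a
position `X`, causal maps and plays coincide.

* A play is causal (`IsPlay.isCausal`).  In a zigzag of monomorphisms, an element which is new at
  some stage only occurs at later stages, and one which disappears only occurs at earlier stages
  (`Composition.eq_of_new`, `Composition.eq_of_old`).  Both are obtained by mapping the colimit to
  a cofree diagram on `Prop`, which turns the universal property of `U` into the possibility of
  defining predicates on its elements stage by stage.
* A causal map is a play (`IsCausal.isPlay`).  Events are attempted following a schedule in which
  each of them occurs infinitely often, and played as soon as their initial position is there; by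
  causality every event is eventually played, and each success is an extended move between
  successive frontiers (`IsCausal.isExtendedMove`).

Causality is a finitary condition, so it passes to unions of increasing sequences of plays
(`exists_isUnion`).  Views have finitely many elements, so a view of such a union is a view of one
of its terms; hence compatible states on the terms glue to a state on the union
(`IsUnion.exists_state`).

Finally, an element of a play is determined by its causal history, a finite word over a countable
alphabet which is preserved by morphisms (`IsCausal.subsingleton_elements`,
`History.elements_map`).  Enumerate all histories, and starting from the given state replace it, at
the `n`-th step, by an extension containing the `n`-th history whenever there is one
(`exists_greedy`).  The union of the resulting sequence is maximal: an element of a further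
extension has some `n`-th history, this extension is also one of the `n`-th state, so the history
was already added.
-/

namespace CCS

open Move Obj

/-! ### Shapes of moves -/

theorem res_id {U : Diagram} {c : Obj} (x : U.obj (op c)) : res (𝟙 c) x = x := by
  simp [res]

theorem res_res {U : Diagram} {b c d : Obj} (f : b ⟶ c) (g : c ⟶ d) (x : U.obj (op d)) :
    res f (res g x) = res (f ≫ g) x := by
  simp [res]

theorem app_res {U V : Diagram} (k : U ⟶ V) {c d : Obj} (f : c ⟶ d) (x : U.obj (op d)) :
    k.app (op c) (res f x) = res f (k.app (op d) x) := by
  simp [res, NatTrans.naturality_apply]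

theorem app_injective {U V : Diagram} (k : U ⟶ V) [Mono k] (c : Objᵒᵖ) :
    Function.Injective (k.app c) :=
  (mono_iff_injective _).1 inferInstance

theorem mem_span_player {μ : Move} {S : ∀ {n : ℕ}, (player n ⟶ move μ) → Prop} {k : ℕ}
    {f : player k ⟶ move μ} : f ∈ (μ.span S).obj (op (player k)) ↔ S f := by
  refine ⟨?_, fun h => ⟨k, f, 𝟙 _, h, by simp⟩⟩
  rintro ⟨n, p, g, hp, rfl⟩
  change Hom (player k) _ at g
  cases g
  rwa [show Hom.id (player k) ≫ p = p from Category.id_comp p]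

theorem not_mem_span_move {μ ν : Move} {S : ∀ {n : ℕ}, (player n ⟶ move μ) → Prop}
    (f : move ν ⟶ move μ) : f ∉ (μ.span S).obj (op (move ν)) := by
  rintro ⟨n, p, g, -, -⟩
  change Hom (move ν) _ at g
  cases g

theorem not_isInitial_and_isFinal {μ : Move} {k : ℕ} (f : player k ⟶ move μ)
    (h : IsInitial f) (h' : IsFinal f) : False := by
  cases h <;> cases h'

theorem isInitial_or_isFinal {μ : Move} {k : ℕ} (f : player k ⟶ move μ) :
    IsInitial f ∨ IsFinal f := by
  change Hom _ _ at f
  cases f <;> first | exact .inl (by constructor) | exact .inr (by constructor)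

/-- All channels of a move belong to its final position. -/
theorem chan_mem_final {μ : Move} (f : chan ⟶ move μ) : f ∈ μ.final.obj (op chan) := by
  change Hom _ _ at f
  cases f with
  | name b i => exact ⟨_, Hom.tgt b rfl, Hom.knows i, .tgt b rfl, rfl⟩
  | forkName i => exact ⟨_, Hom.forkTgtL rfl, Hom.knows i, .forkTgtL rfl, rfl⟩
  | outName i j k => exact ⟨_, Hom.outTgt rfl i j, Hom.knows k, .outTgt rfl i j, rfl⟩
  | inpName i j k h =>
    refine ⟨_, Hom.inpTgt i rfl j, Hom.knows k, .inpTgt i rfl j, ?_⟩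
    exact (dif_neg h).symm

theorem mem_initial_player {μ : Move} {k : ℕ} {f : player k ⟶ move μ} :
    f ∈ μ.initial.obj (op (player k)) ↔ IsInitial f := mem_span_player

theorem mem_final_player {μ : Move} {k : ℕ} {f : player k ⟶ move μ} :
    f ∈ μ.final.obj (op (player k)) ↔ IsFinal f := mem_span_player

theorem IsInitial.not_mem_final {μ : Move} {k : ℕ} {f : player k ⟶ move μ} (h : IsInitial f) :
    f ∉ μ.final.obj (op (player k)) :=
  fun h' => not_isInitial_and_isFinal f h (mem_final_player.1 h')

/-- Elements of a move lying outside its final position are moves or initial players. -/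
theorem not_mem_final {μ : Move} {c : Obj} {f : c ⟶ move μ} (h : f ∉ μ.final.obj (op c)) :
    (∃ ν, c = move ν) ∨ f ∈ μ.initial.obj (op c) := by
  cases c with
  | chan => exact absurd (chan_mem_final f) h
  | player k =>
    rcases isInitial_or_isFinal f with hf | hf
    · exact .inr (mem_initial_player.2 hf)
    · exact absurd (mem_final_player.2 hf) h
  | move ν => exact .inl ⟨ν, rfl⟩

/-- The initial and final position of a move only share channels. -/
theorem mem_interface {μ : Move} {c : Obj} {f : c ⟶ move μ} (h : f ∈ μ.interface.obj (op c)) :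
    c = chan := by
  cases c with
  | chan => rfl
  | player k =>
    exact (not_isInitial_and_isFinal f (mem_initial_player.1 h.1) (mem_final_player.1 h.2)).elim
  | move ν => exact absurd h.1 (not_mem_span_move f)

instance (μ ν : Move) : Subsingleton (move μ ⟶ move ν) :=
  ⟨fun f g => by change Hom _ _ at f g; cases f <;> cases g <;> rfl⟩

/-- Chains of moves in the base category have length at most two. -/
theorem move_eq_of_hom {μ ν κ : Move} (f : move μ ⟶ move ν) (g : move ν ⟶ move κ) (h : μ ≠ ν) :
    ν = κ := by
  change Hom _ _ at f g
  cases f <;> first | exact absurd rfl h | (cases g; rfl)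

/-- Players which are initial in a part of a move are initial in the move. -/
theorem IsInitial.comp {μ ν : Move} {k : ℕ} {f : player k ⟶ move μ} (h : IsInitial f)
    (g : move μ ⟶ move ν) : IsInitial (f ≫ g) := by
  change Hom _ _ at g
  cases h <;> cases g <;> first | exact .src _ _ | exact .forkSrc _ | exact .outSrc _ _ _ |
    exact .inpSrc _ _ _

theorem exists_isInitial (μ : Move) : ∃ (k : ℕ) (f : player k ⟶ move μ), IsInitial f := by
  rcases μ with b | n | ⟨n, i, m, j⟩
  · exact ⟨_, _, .src b rfl⟩
  · exact ⟨_, _, .forkSrc rfl⟩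
  · exact ⟨_, _, .outSrc rfl i j⟩

/-- Moves which closed-world plays may consist of: all but unsynchronised outputs and inputs. -/
def Move.Autonomous : Move → Prop
  | basic (.out _ _) => False
  | basic (.inp _ _) => False
  | _ => True

/-- Enlarging a half-fork into a fork adds no initial player. -/
theorem Move.Autonomous.exists_isInitial {μ ν : Move} (h : μ.Autonomous) (g : move μ ⟶ move ν)
    {k : ℕ} {f : player k ⟶ move ν} (hf : IsInitial f) :
    ∃ f' : player k ⟶ move μ, IsInitial f' ∧ f = f' ≫ g := by
  change Hom _ _ at g
  cases g with
  | id => exact ⟨f, hf, (Category.comp_id f).symm⟩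
  | forkL n => cases hf with | forkSrc e => exact ⟨Hom.src (.parL n) e, .src _ _, rfl⟩
  | forkR n => cases hf with | forkSrc e => exact ⟨Hom.src (.parR n) e, .src _ _, rfl⟩
  | syncOut => exact h.elim
  | syncInp => exact h.elim

/-- The same for arbitrary elements of the initial position. -/
theorem Move.Autonomous.mem_initial {μ ν : Move} (h : μ.Autonomous) (g : move μ ⟶ move ν)
    {c : Obj} {f : c ⟶ move ν} (hf : f ∈ ν.initial.obj (op c)) :
    ∃ f' ∈ μ.initial.obj (op c), f = f' ≫ g := by
  obtain ⟨n, p, i, hp, rfl⟩ := hf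
  obtain ⟨p', hp', rfl⟩ := h.exists_isInitial g hp
  exact ⟨i ≫ p', ⟨n, p', i, hp', rfl⟩, (Category.assoc i p' g).symm⟩

/-! ### Countability of the base category -/

instance : Countable Basic :=
  Function.Injective.countable
    (f := fun b : Basic => (match b with
      | .tick n => (0, n, 0)
      | .parL n => (1, n, 0)
      | .parR n => (2, n, 0)
      | .nu n => (3, n, 0)
      | .out n i => (4, n, i.1)
      | .inp n i => (5, n, i.1) : ℕ × ℕ × ℕ)) (by
    intro b b' h
    cases b <;> cases b' <;> simp at h ⊢ <;> first | exact h | skip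
    all_goals
      obtain ⟨rfl, h⟩ := h
      exact ⟨rfl, heq_of_eq (Fin.ext h)⟩)

instance : Countable Move :=
  Function.Injective.countable
    (f := fun μ : Move => (match μ with
      | .basic b => .inl b
      | .fork n => .inr (.inl n)
      | .sync n i m j => .inr (.inr (⟨n, i⟩, ⟨m, j⟩)) :
        Basic ⊕ ℕ ⊕ (Σ n, Fin n) × (Σ m, Fin m))) (by
    intro μ μ' h
    cases μ <;> cases μ' <;> simp at h ⊢ <;> tauto)

instance : Countable Obj :=
  Function.Injective.countable
    (f := fun c : Obj => (match c with
      | chan => none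
      | player n => some (.inl n)
      | move μ => some (.inr μ) : Option (ℕ ⊕ Move))) (by
    intro c c' h
    cases c <;> cases c' <;> simp at h ⊢ <;> exact h)

/-- A numbering of the morphisms between two objects of the base category: the constructor, and the
index of the channel if the source is `chan`. -/
def homCode : {c d : Obj} → Hom c d → ℕ × ℕ
  | _, _, .id _ => (0, 0)
  | _, _, .knows i => (1, i)
  | _, _, .src _ _ => (2, 0)
  | _, _, .tgt _ _ => (3, 0)
  | _, _, .name _ i => (4, i)
  | _, _, .forkL _ => (5, 0)
  | _, _, .forkR _ => (6, 0)
  | _, _, .forkSrc _ => (7, 0)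
  | _, _, .forkTgtL _ => (8, 0)
  | _, _, .forkTgtR _ => (9, 0)
  | _, _, .forkName i => (10, i)
  | _, _, .syncOut _ _ => (11, 0)
  | _, _, .syncInp _ _ => (12, 0)
  | _, _, .outSrc _ _ _ => (13, 0)
  | _, _, .outTgt _ _ _ => (14, 0)
  | _, _, .inpSrc _ _ _ => (15, 0)
  | _, _, .inpTgt _ _ _ => (16, 0)
  | _, _, .outName _ _ k => (17, k)
  | _, _, .inpName _ _ k _ => (18, k)

/-- A strict bound for the second component of `homCode`. -/
def homBound : Obj → Obj → ℕ
  | chan, player n => n + 1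
  | chan, move (basic b) => b.tgt + 1
  | chan, move (fork n) => n + 1
  | chan, move (sync n _ m _) => n + m + 1
  | _, _ => 1

theorem homCode_lt {c d : Obj} (f : Hom c d) : (homCode f).2 < homBound c d := by
  cases f <;> simp [homCode, homBound] <;> omega

theorem homCode_fst_lt {c d : Obj} (f : Hom c d) : (homCode f).1 < 19 := by
  cases f <;> simp [homCode]

theorem homCode_injective (c d : Obj) : Function.Injective (homCode : Hom c d → ℕ × ℕ) := by
  intro f g h
  cases f <;> cases g <;> simp [homCode] at h ⊢ <;> exact Fin.ext h

instance (c d : Obj) : Finite (c ⟶ d) := by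
  have : Set.Finite (Set.range (homCode : Hom c d → ℕ × ℕ)) :=
    ((Set.finite_Iio 19).prod (Set.finite_Iio (homBound c d))).subset (by
      rintro _ ⟨f, rfl⟩
      exact ⟨homCode_fst_lt f, homCode_lt f⟩)
  exact Set.finite_range_iff (homCode_injective c d) |>.1 this

/-! ### Causal diagrams -/

/-- A move of a diagram is an event when it is not part of a larger move. -/
def IsEvent {U : Diagram} {μ : Move} (e : U.obj (op (move μ))) : Prop :=
  ∀ (ν : Move) (g : move μ ⟶ move ν) (e' : U.obj (op (move ν))), e = res g e' → μ = ν

theorem exists_isEvent {U : Diagram} {μ : Move} (e : U.obj (op (move μ))) :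
    ∃ (ν : Move) (g : move μ ⟶ move ν) (e' : U.obj (op (move ν))), IsEvent e' ∧ e = res g e' := by
  by_cases h : IsEvent e
  · exact ⟨μ, 𝟙 _, e, h, (res_id e).symm⟩
  · simp only [IsEvent, not_forall] at h
    obtain ⟨ν, g, e', he, hne⟩ := h
    exact ⟨ν, g, e', fun κ g' _ _ => move_eq_of_hom g g' hne, he⟩

/-- In a closed-world diagram outputs and inputs are parts of synchronisations, hence not events. -/
theorem IsEvent.autonomous {U : Diagram} (hU : IsClosedWorld U) {μ : Move}
    {e : U.obj (op (move μ))} (he : IsEvent e) : μ.Autonomous := by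
  rcases μ with (n | n | n | n | ⟨n, i⟩ | ⟨n, i⟩) | n | ⟨n, i, m, j⟩
  case basic.out =>
    obtain ⟨m, j, y, hy⟩ := hU.out n i e
    cases he _ _ y hy.symm
  case basic.inp =>
    obtain ⟨m, j, y, hy⟩ := hU.inp n i e
    cases he _ _ y hy.symm
  all_goals trivial

/-- The converse fails: a half-fork which is an event of `U` may be part of a fork of `V`. -/
theorem IsEvent.of_app {U V : Diagram} (k : U ⟶ V) {μ : Move} {e : U.obj (op (move μ))}
    (h : IsEvent (k.app _ e)) : IsEvent e := by
  rintro ν g e' rfl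
  exact h ν g (k.app _ e') (app_res k g e')

/-- The elements of `U` which are caused, in finitely many steps, by the elements of `X`: a step
is an autonomous move, all of whose initial players have been reached. -/
inductive Reached {X U : Diagram} (u : X ⟶ U) : ∀ {c : Obj}, U.obj (op c) → Prop
  | base {c : Obj} (p : X.obj (op c)) : Reached u (u.app _ p)
  | step {μ : Move} (hμ : μ.Autonomous) (e : U.obj (op (move μ)))
      (h : ∀ {k : ℕ} (f : player k ⟶ move μ), IsInitial f → Reached u (res f e))
      {c : Obj} (f : c ⟶ move μ) : Reached u (res f e)

theorem Reached.map {X U V : Diagram} {u : X ⟶ U} (k : U ⟶ V) {c : Obj} {x : U.obj (op c)}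
    (h : Reached u x) : Reached (u ≫ k) (k.app _ x) := by
  induction h with
  | base p => exact .base p
  | step hμ e _ f ih =>
    rw [app_res]
    exact .step hμ _ (fun f hf => by rw [← app_res]; exact ih f hf) f

/-- The causal description of closed-world plays `u : X ⟶ U`: every element of `U` outside `X` is
created by exactly one event, every player is consumed by at most one event, and everything has a
finite causal history starting from `X`. -/
structure IsCausal {X U : Diagram} (u : X ⟶ U) : Prop where
  base_inj : ∀ c, Function.Injective (u.app c)
  new_inj : ∀ {c : Obj} {μ μ' : Move} {e : U.obj (op (move μ))} {e' : U.obj (op (move μ'))}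
    {f : c ⟶ move μ} {f' : c ⟶ move μ'}, IsEvent e → IsEvent e' →
    f ∉ μ.initial.obj (op c) → f' ∉ μ'.initial.obj (op c) → res f e = res f' e' →
    (⟨μ, e, f⟩ : Σ μ, U.obj (op (move μ)) × (c ⟶ move μ)) = ⟨μ', e', f'⟩
  new_ne_base : ∀ {c : Obj} {μ : Move} {e : U.obj (op (move μ))} {f : c ⟶ move μ},
    IsEvent e → f ∉ μ.initial.obj (op c) → ∀ p, res f e ≠ u.app (op c) p
  old_inj : ∀ {c : Obj} {μ μ' : Move} {e : U.obj (op (move μ))} {e' : U.obj (op (move μ'))}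
    {f : c ⟶ move μ} {f' : c ⟶ move μ'}, IsEvent e → IsEvent e' →
    f ∉ μ.final.obj (op c) → f' ∉ μ'.final.obj (op c) → res f e = res f' e' →
    (⟨μ, e, f⟩ : Σ μ, U.obj (op (move μ)) × (c ⟶ move μ)) = ⟨μ', e', f'⟩
  reached : ∀ {c : Obj} (x : U.obj (op c)), Reached u x

/-- A move is determined by any of its initial players. -/
theorem IsCausal.eq_of_initial {X U : Diagram} {u : X ⟶ U} (hu : IsCausal u) {μ : Move}
    {e e' : U.obj (op (move μ))} {k : ℕ} {f : player k ⟶ move μ} (hf : IsInitial f)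
    (h : res f e = res f e') : e = e' := by
  obtain ⟨ν, g, d, hd, rfl⟩ := exists_isEvent e
  obtain ⟨ν', g', d', hd', rfl⟩ := exists_isEvent e'
  rw [res_res, res_res] at h
  have := hu.old_inj hd hd' (hf.comp g).not_mem_final (hf.comp g').not_mem_final h
  obtain ⟨rfl, this⟩ := Sigma.mk.inj this
  rw [(Prod.mk.inj (eq_of_heq this)).1, Subsingleton.elim g g']

/-- An increasing union `L` of causal diagrams is causal, since each condition only involves
finitely many elements at a time.  Steps of causal histories need not be events, so histories in
`U n` remain valid in `L`. -/
theorem IsCausal.of_directed {X L : Diagram} {v : X ⟶ L} {U : ℕ → Diagram} {u : ∀ n, X ⟶ U n}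
    {i : ∀ n, U n ⟶ U (n + 1)} {ι : ∀ n, U n ⟶ L} (hι : ∀ n c, Function.Injective ((ι n).app c))
    (hi : ∀ n, i n ≫ ι (n + 1) = ι n) (hv : ∀ n, u n ≫ ι n = v)
    (hs : ∀ c (x : L.obj c), ∃ n y, (ι n).app c y = x) (hu : ∀ n, IsCausal (u n)) :
    IsCausal v := by
  have lift : ∀ n m, n ≤ m → ∀ c (x : (U n).obj c), ∃ y, (ι m).app c y = (ι n).app c x := by
    intro n m h c x
    induction m, h using Nat.le_induction with
    | base => exact ⟨x, rfl⟩
    | succ m _ ih =>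
      obtain ⟨y, hy⟩ := ih
      refine ⟨(i m).app c y, ?_⟩
      rw [← hy, ← hi m]
      rfl
  have two : ∀ c c' (x : L.obj c) (y : L.obj c'),
      ∃ n x' y', (ι n).app c x' = x ∧ (ι n).app c' y' = y := by
    intro c c' x y
    obtain ⟨n, x, rfl⟩ := hs c x
    obtain ⟨m, y, rfl⟩ := hs c' y
    obtain ⟨x', hx⟩ := lift n (max n m) (le_max_left _ _) c x
    obtain ⟨y', hy⟩ := lift m (max n m) (le_max_right _ _) c' y
    exact ⟨_, x', y', hx, hy⟩
  constructor
  · intro c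
    rw [← hv 0]
    exact (hι 0 c).comp ((hu 0).base_inj c)
  · intro c μ μ' e e' f f' he he' hf hf' h
    obtain ⟨n, e, e', rfl, rfl⟩ := two _ _ e e'
    rw [← app_res, ← app_res] at h
    cases (hu n).new_inj he.of_app he'.of_app hf hf' (hι n _ h)
    rfl
  · intro c μ e f he hf p h
    obtain ⟨n, e, rfl⟩ := hs _ e
    rw [← app_res, ← hv n] at h
    exact (hu n).new_ne_base he.of_app hf p (hι n _ h)
  · intro c μ μ' e e' f f' he he' hf hf' h
    obtain ⟨n, e, e', rfl, rfl⟩ := two _ _ e e'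
    rw [← app_res, ← app_res] at h
    cases (hu n).old_inj he.of_app he'.of_app hf hf' (hι n _ h)
    rfl
  · intro c x
    obtain ⟨n, x, rfl⟩ := hs _ x
    rw [← hv n]
    exact ((hu n).reached x).map (ι n)

/-! ### Causal histories -/

/-- A step of a causal history: the type of a move, one of its initial players, and one of its
elements. -/
abbrev Step : Type :=
  Σ (μ : Move) (k : ℕ) (c : Obj), (player k ⟶ move μ) × (c ⟶ move μ)

/-- A causal history: an element of the base, and a list of steps leading from it. -/
abbrev History (X : Diagram) : Type := (Σ c, X.obj (op c)) × List Step

/-- The elements described by a causal history.  The last step is the head of the list. -/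
def History.elements {X U : Diagram} (u : X ⟶ U) (x : Σ c, X.obj (op c)) :
    List Step → Set (Σ c, U.obj (op c))
  | [] => {⟨x.1, u.app _ x.2⟩}
  | s :: l => {y | IsInitial s.2.2.2.1 ∧ ∃ e : U.obj (op (move s.1)),
      ⟨_, res s.2.2.2.1 e⟩ ∈ History.elements u x l ∧ y = ⟨_, res s.2.2.2.2 e⟩}

/-- In a causal diagram a causal history describes at most one element. -/
theorem IsCausal.subsingleton_elements {X U : Diagram} {u : X ⟶ U} (hu : IsCausal u)
    (x : Σ c, X.obj (op c)) (l : List Step) : (History.elements u x l).Subsingleton := by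
  induction l with
  | nil => exact Set.subsingleton_singleton
  | cons s l ih =>
    rintro _ ⟨hs, e, he, rfl⟩ _ ⟨-, e', he', rfl⟩
    have := ih he he'
    rw [hu.eq_of_initial hs (eq_of_heq (Sigma.mk.inj this).2)]

theorem Reached.exists_history {X U : Diagram} {u : X ⟶ U} {c : Obj} {x : U.obj (op c)}
    (h : Reached u x) : ∃ a : History X, ⟨c, x⟩ ∈ History.elements u a.1 a.2 := by
  induction h with
  | base p => exact ⟨⟨⟨_, p⟩, []⟩, rfl⟩
  | @step μ _ e _ c f ih =>
    obtain ⟨k, f₀, hf₀⟩ := exists_isInitial μ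
    obtain ⟨⟨x, l⟩, h⟩ := ih f₀ hf₀
    exact ⟨⟨x, ⟨μ, k, c, f₀, f⟩ :: l⟩, hf₀, e, h, rfl⟩

theorem History.elements_map {X U V : Diagram} {u : X ⟶ U} (k : U ⟶ V) (x : Σ c, X.obj (op c))
    (l : List Step) {c : Obj} {y : U.obj (op c)} (h : ⟨c, y⟩ ∈ History.elements u x l) :
    (⟨c, k.app _ y⟩ : Σ c, V.obj (op c)) ∈ History.elements (u ≫ k) x l := by
  induction l generalizing c with
  | nil => cases h; rfl
  | cons s l ih =>
    obtain ⟨hs, e, he, hy⟩ := h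
    cases hy
    exact ⟨hs, k.app _ e, by rw [← app_res]; exact ih he, by rw [app_res]⟩

theorem countable_history {X : Diagram} (hX : IsPosition X) : Countable (History X) := by
  have := hX.countable
  infer_instance

/-- A causal diagram has at most as many elements as there are causal histories. -/
theorem IsCausal.countable {X U : Diagram} (hX : IsPosition X) {u : X ⟶ U} (hu : IsCausal u) :
    Countable (Σ c, U.obj (op c)) := by
  have := countable_history hX
  choose a ha using fun x : Σ c, U.obj (op c) => (hu.reached x.2).exists_history
  refine Function.Injective.countable (f := a) fun x y h => ?_
  exact hu.subsingleton_elements _ _ (ha x) (h ▸ ha y)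

/-! ### Zigzags of monomorphisms -/

/-- The cofree diagram on a type `A` over an object `c` of the base category: maps into it are
functions with values in `A` on the elements over `c`. -/
def cofree (c : Obj) (A : Type) : Diagram where
  obj d := (c ⟶ unop d) → A
  map f := ↾fun g h => g (h ≫ f.unop)

/-- The map of diagrams corresponding to a function on elements over `c`. -/
def toCofree {c : Obj} {A : Type} {M : Diagram} (φ : M.obj (op c) → A) : M ⟶ cofree c A where
  app d := ↾fun x h => φ (M.map h.op x)
  naturality d e f := by
    ext x
    funext h
    simp [cofree]

theorem toCofree_app {c : Obj} {A : Type} {M : Diagram} (φ : M.obj (op c) → A)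
    (x : M.obj (op c)) : (toCofree φ).app (op c) x (𝟙 c) = φ x := by
  change φ (M.map (𝟙 c).op x) = φ x
  simp

theorem comp_toCofree {c : Obj} {A : Type} {M N : Diagram} (f : N ⟶ M)
    (φ : M.obj (op c) → A) : f ≫ toCofree φ = toCofree (fun x => φ (f.app _ x)) := by
  ext d x
  funext h
  exact congrArg φ (NatTrans.naturality_apply f h.op x).symm

namespace Composition

variable {P U : Diagram} {u : P ⟶ U}

/-- Functions on the elements of the colimit can be defined stagewise. -/
theorem exists_desc (C : Composition u) {c : Obj} {A : Type} (φ : ∀ n, (C.M n).obj (op c) → A)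
    (h : ∀ n z, φ n ((C.b n).app _ z) = φ (n + 1) ((C.a (n + 1)).app _ z)) :
    ∃ ψ : U.obj (op c) → A, ∀ n y, ψ ((C.m n).app _ y) = φ n y := by
  obtain ⟨v, hv, -⟩ := C.desc (cofree c A) (fun n => toCofree (φ n)) fun n => by
    rw [comp_toCofree, comp_toCofree]
    exact congrArg toCofree (funext (h n))
  refine ⟨fun x => v.app _ x (𝟙 c), fun n y => ?_⟩
  rw [← toCofree_app (φ n), ← hv n]
  rfl

/-- The stages are jointly surjective: otherwise the predicates `True` and being hit by some stage
would be two distinct maps to the cofree diagram which agree on all stages. -/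
theorem exists_rep (C : Composition u) {c : Obj} (x : U.obj (op c)) :
    ∃ n y, (C.m n).app _ y = x := by
  let φ : U.obj (op c) → Prop := fun x => ∃ n y, (C.m n).app _ y = x
  let t : U.obj (op c) → Prop := fun _ => True
  obtain ⟨v, -, hv⟩ := C.desc (cofree c Prop) (fun n => C.m n ≫ toCofree t) fun n => by
    rw [← Category.assoc, C.glue, Category.assoc]
  have h₁ := hv (toCofree t) fun n => rfl
  have h₂ := hv (toCofree φ) fun n => by
    rw [comp_toCofree, comp_toCofree]
    exact congrArg toCofree (funext fun y => eq_true ⟨n, y, rfl⟩)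
  have : φ x = t x := by rw [← toCofree_app φ, ← toCofree_app t, h₁, h₂]
  exact of_eq_true this

/-- The trace, on later stages, of the element `y` of stage `n`. -/
inductive Later (C : Composition u) {c : Obj} (n : ℕ) (y : (C.M n).obj (op c)) :
    ∀ k, (C.M k).obj (op c) → Prop
  | refl : Later C n y n y
  | step (k : ℕ) (z : (C.X (k + 1)).obj (op c)) :
      Later C n y k ((C.b k).app _ z) → Later C n y (k + 1) ((C.a (k + 1)).app _ z)

/-- The trace, on earlier stages, of the element `y` of stage `n`. -/
inductive Earlier (C : Composition u) {c : Obj} (n : ℕ) (y : (C.M n).obj (op c)) :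
    ∀ k, (C.M k).obj (op c) → Prop
  | refl : Earlier C n y n y
  | step (k : ℕ) (z : (C.X (k + 1)).obj (op c)) :
      Earlier C n y (k + 1) ((C.a (k + 1)).app _ z) → Earlier C n y k ((C.b k).app _ z)

variable {C : Composition u} {c : Obj} {n : ℕ} {y : (C.M n).obj (op c)}

theorem Later.inv {k : ℕ} {x : (C.M k).obj (op c)} (h : Later C n y k x) :
    (⟨k, x⟩ : Σ k, (C.M k).obj (op c)) = ⟨n, y⟩ ∨ n < k ∧ ∃ j z, Later C n y j ((C.b j).app _ z) ∧
      (⟨k, x⟩ : Σ k, (C.M k).obj (op c)) = ⟨j + 1, (C.a (j + 1)).app _ z⟩ := by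
  induction h with
  | refl => exact .inl rfl
  | step k z h ih =>
    refine .inr ⟨?_, k, z, h, rfl⟩
    rcases ih with ih | ih
    · have := congrArg Sigma.fst ih
      dsimp only at this
      omega
    · omega

theorem Earlier.inv {k : ℕ} {x : (C.M k).obj (op c)} (h : Earlier C n y k x) :
    (⟨k, x⟩ : Σ k, (C.M k).obj (op c)) = ⟨n, y⟩ ∨ k < n ∧ ∃ j z,
      Earlier C n y (j + 1) ((C.a (j + 1)).app _ z) ∧
      (⟨k, x⟩ : Σ k, (C.M k).obj (op c)) = ⟨j, (C.b j).app _ z⟩ := by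
  induction h with
  | refl => exact .inl rfl
  | step k z h ih =>
    refine .inr ⟨?_, k, z, h, rfl⟩
    rcases ih with ih | ih
    · have := congrArg Sigma.fst ih
      dsimp only at this
      omega
    · omega

/-- An element which is new at stage `n` only occurs at later stages. -/
theorem eq_of_new (ha : ∀ n, Mono (C.a n)) (hy : n = 0 ∨ y ∉ Set.range ((C.a n).app (op c)))
    {k : ℕ} {x : (C.M k).obj (op c)} (h : (C.m k).app _ x = (C.m n).app _ y) :
    n < k ∨ (⟨k, x⟩ : Σ k, (C.M k).obj (op c)) = ⟨n, y⟩ := by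
  obtain ⟨ψ, hψ⟩ := C.exists_desc (c := c) (fun k x => Later C n y k x) fun k z => by
    refine propext ⟨.step k z, fun h => ?_⟩
    rcases h.inv with h | ⟨-, j, z', h, e⟩
    · cases h
      rcases hy with hy | hy
      · cases hy
      · exact absurd ⟨z, rfl⟩ hy
    · obtain ⟨e₁, e₂⟩ := Sigma.mk.inj e
      obtain rfl : k = j := by omega
      rwa [app_injective (C.a (k + 1)) _ (eq_of_heq e₂)]
  have : Later C n y k x := by
    rw [← hψ, h, hψ]
    exact .refl
  exact this.inv.symm.imp_left And.left

/-- An element which disappears after stage `n` only occurs at earlier stages. -/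
theorem eq_of_old (hb : ∀ n, Mono (C.b n)) (hy : y ∉ Set.range ((C.b n).app (op c)))
    {k : ℕ} {x : (C.M k).obj (op c)} (h : (C.m k).app _ x = (C.m n).app _ y) :
    k < n ∨ (⟨k, x⟩ : Σ k, (C.M k).obj (op c)) = ⟨n, y⟩ := by
  obtain ⟨ψ, hψ⟩ := C.exists_desc (c := c) (fun k x => Earlier C n y k x) fun k z => by
    refine propext ⟨fun h => ?_, .step k z⟩
    rcases h.inv with h | ⟨-, j, z', h, e⟩
    · cases h
      exact absurd ⟨z, rfl⟩ hy
    · obtain ⟨rfl, e₂⟩ := Sigma.mk.inj e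
      rwa [app_injective (C.b k) _ (eq_of_heq e₂)]
  have : Earlier C n y k x := by
    rw [← hψ, h, hψ]
    exact .refl
  exact this.inv.symm.imp_left And.left

end Composition

/-! ### Extended moves -/

/-- In a pushout of sets, elements of `X₂` outside the range of `t` are not identified with other
elements of `X₂`. -/
theorem eq_or_mem_range_of_isPushout {X₁ X₂ X₃ X₄ : Type} {t : X₁ ⟶ X₂} {l : X₁ ⟶ X₃}
    {r : X₂ ⟶ X₄} {b : X₃ ⟶ X₄} (h : IsPushout t l r b) {x y : X₂} (e : r x = r y) :
    x = y ∨ x ∈ Set.range t := by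
  by_contra! hx
  have w : t ≫ (↾fun z => (z = x : Prop)) = l ≫ (↾fun _ => False) := by
    ext z
    exact iff_false_intro fun hz => hx.2 ⟨z, hz⟩
  have h₁ := fun z => ConcreteCategory.congr_hom (h.inl_desc _ _ w) z
  have h₂ := (h₁ x).symm.trans ((congrArg (h.desc _ _ w) e).trans (h₁ y))
  exact hx.1 (Eq.mp h₂ rfl).symm

theorem isPushout_app {A B C D : Diagram} {t : A ⟶ B} {l : A ⟶ C} {r : B ⟶ D} {b : C ⟶ D}
    (h : IsPushout t l r b) (c : Objᵒᵖ) : IsPushout (t.app c) (l.app c) (r.app c) (b.app c) :=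
  h.map ((evaluation _ _).obj c)

theorem eq_iff_of_isPushout {X₁ X₂ X₃ X₄ : Type} {t : X₁ ⟶ X₂} {l : X₁ ⟶ X₃}
    {r : X₂ ⟶ X₄} {b : X₃ ⟶ X₄} (h : IsPushout t l r b) (ht : Function.Injective t)
    {x : X₂} {y : X₃} : r x = b y ↔ ∃ s, t s = x ∧ l s = y :=
  Types.pushoutCocone_inl_eq_inr_iff_of_isColimit h.isColimit ht x y

theorem injective_of_isPushout {X₁ X₂ X₃ X₄ : Type} {t : X₁ ⟶ X₂} {l : X₁ ⟶ X₃}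
    {r : X₂ ⟶ X₄} {b : X₃ ⟶ X₄} (h : IsPushout t l r b) (ht : Function.Injective t) :
    Function.Injective b :=
  Types.pushoutCocone_inr_injective_of_isColimit h.isColimit ht

/-- One leg `a : X ⟶ M` of an extended move, where `A` is the initial or the final position of `μ`:
it is injective, it meets the move `μ` in `A` only, and `M` is covered by `X` and `μ`. -/
theorem leg_facts {μ : Move} {A : Subfunctor μ.diagram} (hA : μ.interface ≤ A) {X Z M : Diagram}
    {f : μ.interface.toFunctor ⟶ Z} {x₀ : A.toFunctor ⟶ X} {x₁ : Z ⟶ X} {m₀ : μ.diagram ⟶ M}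
    {m₁ : Z ⟶ M} {a : X ⟶ M} (hX : IsPushout (Subfunctor.homOfLe hA) f x₀ x₁)
    (hM : IsPushout μ.interface.ι f m₀ m₁) (h₀ : x₀ ≫ a = A.ι ≫ m₀) (h₁ : x₁ ≫ a = m₁)
    (c : Objᵒᵖ) :
    Function.Injective (a.app c) ∧
    (∀ p : μ.diagram.obj c, m₀.app c p ∈ Set.range (a.app c) ↔ p ∈ A.obj c) ∧
    ∀ y : M.obj c, (∃ p, m₀.app c p = y) ∨ y ∈ Set.range (a.app c) := by
  have hX := isPushout_app hX c
  have hM := isPushout_app hM c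
  have h₀ : ∀ p : A.toFunctor.obj c, a.app c (x₀.app c p) = m₀.app c p.1 := fun p =>
    ConcreteCategory.congr_hom (NatTrans.congr_app h₀ c) p
  have h₁ : ∀ z, a.app c (x₁.app c z) = m₁.app c z := fun z =>
    ConcreteCategory.congr_hom (NatTrans.congr_app h₁ c) z
  have hw : ∀ s : μ.interface.toFunctor.obj c,
      x₀.app c ⟨s.1, hA c s.2⟩ = x₁.app c (f.app c s) := fun s =>
    ConcreteCategory.congr_hom hX.w s
  have hmw : ∀ s : μ.interface.toFunctor.obj c,
      m₀.app c s.1 = m₁.app c (f.app c s) := fun s =>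
    ConcreteCategory.congr_hom hM.w s
  have hi : Function.Injective (μ.interface.ι.app c) := fun x y h => Subtype.ext h
  have m₁i := injective_of_isPushout hM hi
  have glue : ∀ (p : A.toFunctor.obj c) z, m₀.app c p.1 = m₁.app c z →
      x₀.app c p = x₁.app c z := by
    intro p z h
    obtain ⟨s, hs, rfl⟩ := (eq_iff_of_isPushout hM hi).1 h
    rw [← hw s]
    exact congrArg _ (Subtype.ext hs.symm)
  refine ⟨?_, fun p => ⟨?_, fun hp => ⟨x₀.app c ⟨p, hp⟩, h₀ _⟩⟩, fun y => ?_⟩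
  · intro x x' h
    obtain ⟨p, rfl⟩ | ⟨z, rfl⟩ := Types.eq_or_eq_of_isPushout hX x <;>
    obtain ⟨p', rfl⟩ | ⟨z', rfl⟩ := Types.eq_or_eq_of_isPushout hX x'
    · rw [h₀, h₀] at h
      obtain h' | ⟨s, hs⟩ := eq_or_mem_range_of_isPushout hM h
      · rw [Subtype.ext h']
      · have hp' : m₀.app c p'.1 = m₁.app c (f.app c s) := by
          rw [← h, ← hmw]
          exact congrArg _ hs.symm
        rw [glue p' _ hp', glue p _ (h.trans hp')]
    · rw [h₀, h₁] at h
      exact glue p z' h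
    · rw [h₀, h₁] at h
      exact (glue p' z h.symm).symm
    · rw [h₁, h₁] at h
      rw [m₁i h]
  · rintro ⟨x, hx⟩
    obtain ⟨q, rfl⟩ | ⟨z, rfl⟩ := Types.eq_or_eq_of_isPushout hX x
    · rw [h₀] at hx
      obtain h' | ⟨s, hs⟩ := eq_or_mem_range_of_isPushout hM hx.symm
      · exact h' ▸ q.2
      · exact hs ▸ hA c s.2
    · rw [h₁] at hx
      obtain ⟨s, hs, -⟩ := (eq_iff_of_isPushout hM hi).1 hx.symm
      exact hs ▸ hA c s.2
  · obtain ⟨p, rfl⟩ | ⟨z, rfl⟩ := Types.eq_or_eq_of_isPushout hM y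
    · exact .inl ⟨p, rfl⟩
    · exact .inr ⟨x₁.app c z, h₁ z⟩

/-- Diagrams without moves. -/
def IsStatic (X : Diagram) : Prop := ∀ μ : Move, IsEmpty (X.obj (op (move μ)))

theorem isStatic_of_isPushout {μ : Move} {S : ∀ {n : ℕ}, (player n ⟶ move μ) → Prop}
    (hA : μ.interface ≤ μ.span S) {X Z : Diagram} {f : μ.interface.toFunctor ⟶ Z}
    {x₀ : (μ.span S).toFunctor ⟶ X} {x₁ : Z ⟶ X} (hZ : IsStatic Z)
    (hX : IsPushout (Subfunctor.homOfLe hA) f x₀ x₁) : IsStatic X := fun ν => ⟨fun x => by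
  obtain ⟨p, -⟩ | ⟨z, -⟩ := Types.eq_or_eq_of_isPushout (isPushout_app hX _) x
  · exact not_mem_span_move p.1 p.2
  · exact (hZ ν).false z⟩

/-- What the elements of an extended move `X ⟶ M ⟵ Y` look like: `y` is the move itself, that is,
the image of the generic element of the diagram representing `μ`. -/
structure ExtendedMoveAt {X M Y : Diagram} (a : X ⟶ M) (b : Y ⟶ M) (μ : Move)
    (y : M.obj (op (move μ))) : Prop where
  mem_range_left : ∀ {c : Obj} (f : c ⟶ move μ),
    res f y ∈ Set.range (a.app (op c)) ↔ f ∈ μ.initial.obj (op c)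
  mem_range_right : ∀ {c : Obj} (f : c ⟶ move μ),
    res f y ∈ Set.range (b.app (op c)) ↔ f ∈ μ.final.obj (op c)
  cover : ∀ {c : Obj} (x : M.obj (op c)), (∃ f, res f y = x) ∨ x ∈ Set.range (a.app (op c))
  inj : ∀ {c : Obj} {f f' : c ⟶ move μ}, f ∉ μ.interface.obj (op c) → res f y = res f' y → f = f'

theorem IsExtendedMove.exists_at {X M Y : Diagram} {a : X ⟶ M} {b : Y ⟶ M}
    (h : IsExtendedMove a b) : Mono a ∧ Mono b ∧ IsStatic X ∧ IsStatic Y ∧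
      ∃ μ y, ExtendedMoveAt a b μ y := by
  obtain ⟨μ, Z, f, x₀, x₁, m₀, m₁, y₀, y₁, hZ, hX, hM, hY, h₁, h₂, h₃, h₄⟩ := h
  have ha := leg_facts _ hX hM h₁ h₂
  have hb := leg_facts _ hY hM h₃ h₄
  have hm : ∀ {c : Obj} (f : c ⟶ move μ),
      res f (m₀.app (op (move μ)) (𝟙 (move μ))) = m₀.app (op c) f := by
    intro c f
    rw [← app_res]
    exact congrArg _ (Category.comp_id f)
  have mono : ∀ {V W : Diagram} (k : V ⟶ W), (∀ c, Function.Injective (k.app c)) → Mono k := by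
    intro V W k hk
    have := fun c => (mono_iff_injective (k.app c)).2 (hk c)
    exact NatTrans.mono_of_mono_app k
  refine ⟨mono a fun c => (ha c).1, mono b fun c => (hb c).1,
    isStatic_of_isPushout _ hZ.noMove hX, isStatic_of_isPushout _ hZ.noMove hY, μ,
    m₀.app _ (𝟙 (move μ)), ?_, ?_, ?_, ?_⟩
  · intro c f
    rw [hm]
    exact (ha _).2.1 f
  · intro c f
    rw [hm]
    exact (hb _).2.1 f
  · intro c x
    obtain ⟨p, hp⟩ | h := (ha _).2.2 x
    · exact .inl ⟨p, (hm p).trans hp⟩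
    · exact .inr h
  · intro c f f' hf h
    rw [hm, hm] at h
    obtain h | ⟨s, rfl⟩ := eq_or_mem_range_of_isPushout (isPushout_app hM _) h
    · exact h
    · exact absurd s.2 hf

/-! ### Closed-world plays are causal -/

theorem IsStatic.of_hom {X Y : Diagram} (f : X ⟶ Y) (h : IsStatic Y) : IsStatic X :=
  fun μ => ⟨fun x => (h μ).false (f.app _ x)⟩

theorem app_surjective {U V : Diagram} (k : U ⟶ V) [IsIso k] (c : Objᵒᵖ) :
    Function.Surjective (k.app c) :=
  ((isIso_iff_bijective _).1 inferInstance).2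

namespace Composition

variable {P U : Diagram} {u : P ⟶ U} {C : Composition u}

theorem fac_apply (C : Composition u) {c : Objᵒᵖ} (p : P.obj c) :
    u.app c p = (C.m 0).app c ((C.a 0).app c (C.start.hom.app c p)) :=
  (ConcreteCategory.congr_hom (NatTrans.congr_app C.fac c) p).symm

theorem OfMoves.isStatic (hC : C.OfMoves) (hP : IsPosition P) (n : ℕ) : IsStatic (C.X n) := by
  induction n with
  | zero => exact .of_hom C.start.inv hP.noMove
  | succ n ih =>
    obtain h | ⟨_, _⟩ := hC n
    · exact h.exists_at.2.2.2.1
    · exact .of_hom (C.b n ≫ inv (C.a n)) ih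

theorem OfMoves.mono_a (hC : C.OfMoves) (n : ℕ) : Mono (C.a n) := by
  obtain h | ⟨_, _⟩ := hC n
  · exact h.exists_at.1
  · infer_instance

theorem OfMoves.mono_b (hC : C.OfMoves) (n : ℕ) : Mono (C.b n) := by
  obtain h | ⟨_, _⟩ := hC n
  · exact h.exists_at.2.1
  · infer_instance

/-- Every event of a composition is the move of exactly one of the composed cospans. -/
theorem OfMoves.exists_stage (hC : C.OfMoves) (hP : IsPosition P) {μ : Move}
    {e : U.obj (op (move μ))} (he : IsEvent e) :
    ∃ n y, (C.m n).app _ y = e ∧ ExtendedMoveAt (C.a n) (C.b n) μ y ∧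
      ∀ (μ' : Move) (y' : (C.M n).obj (op (move μ'))), IsEvent ((C.m n).app _ y') →
        (⟨μ', y'⟩ : Σ μ, (C.M n).obj (op (move μ))) = ⟨μ, y⟩ := by
  obtain ⟨n, y, rfl⟩ := C.exists_rep e
  have hX := hC.isStatic hP n
  obtain h | ⟨ha, _⟩ := hC n
  · obtain ⟨-, -, -, -, μ₀, y₀, h⟩ := h.exists_at
    have key : ∀ (μ' : Move) (y' : (C.M n).obj (op (move μ'))), IsEvent ((C.m n).app _ y') →
        (⟨μ', y'⟩ : Σ μ, (C.M n).obj (op (move μ))) = ⟨μ₀, y₀⟩ := by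
      intro μ' y' hy'
      obtain ⟨f, rfl⟩ | ⟨x, -⟩ := h.cover y'
      · cases hy' μ₀ f ((C.m n).app _ y₀) (app_res _ _ _)
        rw [Subsingleton.elim f (𝟙 _), res_id]
      · exact ((hX _).false x).elim
    cases key μ y he
    exact ⟨n, y, rfl, h, key⟩
  · obtain ⟨x, -⟩ := app_surjective (C.a n) _ y
    exact ((hX _).false x).elim

theorem OfMoves.reached (hC : C.OfMoves) (hP : IsPosition P) (hU : IsClosedWorld U) (n : ℕ)
    {c : Obj} (y : (C.M n).obj (op c)) : Reached u ((C.m n).app _ y) := by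
  have step : ∀ n, (∀ {c : Obj} (z : (C.X n).obj (op c)),
      Reached u ((C.m n).app _ ((C.a n).app _ z))) →
      ∀ {c : Obj} (y : (C.M n).obj (op c)), Reached u ((C.m n).app _ y) := by
    intro n ih c y
    obtain h | ⟨_, _⟩ := hC n
    · obtain ⟨-, -, -, -, μ, y₀, h⟩ := h.exists_at
      obtain ⟨f, rfl⟩ | ⟨z, rfl⟩ := h.cover y
      · have he : IsEvent ((C.m n).app _ y₀) := by
          -- A larger move of `U` would come from the same stage, all of which is part of `y₀`.
          intro ν g e' hg
          have hnew : ∀ n (x : (C.M n).obj (op (move μ))),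
              x ∉ Set.range ((C.a n).app (op (move μ))) :=
            fun n x ⟨z, _⟩ => (hC.isStatic hP n μ).false z
          obtain ⟨k, y', rfl⟩ := C.exists_rep e'
          rw [← app_res] at hg
          obtain hk | hk := eq_of_new hC.mono_a (.inr (hnew _ _)) hg
          · obtain hk' | hk' := eq_of_new hC.mono_a (.inr (hnew _ _)) hg.symm
            · omega
            · have := congrArg Sigma.fst hk'
              dsimp only at this
              omega
          · obtain ⟨rfl, -⟩ := Sigma.mk.inj hk
            obtain ⟨f', -⟩ | ⟨x, -⟩ := h.cover y'
            · by_contra hne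
              exact hne (move_eq_of_hom g f' hne).symm
            · exact ((hC.isStatic hP n _).false x).elim
        rw [app_res]
        refine .step (he.autonomous hU) _ (fun f hf => ?_) f
        rw [← app_res]
        obtain ⟨z, hz⟩ := (h.mem_range_left f).2 (mem_initial_player.2 hf)
        rw [← hz]
        exact ih z
      · exact ih z
    · obtain ⟨z, rfl⟩ := app_surjective (C.a n) _ y
      exact ih z
  induction n generalizing c with
  | zero =>
    refine step 0 (fun {c} z => ?_) y
    obtain ⟨p, rfl⟩ := app_surjective C.start.hom _ z
    rw [← C.fac_apply]
    exact .base p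
  | succ n ih =>
    refine step (n + 1) (fun {c} z => ?_) y
    have : (C.m (n + 1)).app _ ((C.a (n + 1)).app _ z) = (C.m n).app _ ((C.b n).app _ z) :=
      (ConcreteCategory.congr_hom (NatTrans.congr_app (C.glue n) _) z).symm
    rw [this]
    exact ih _

theorem OfMoves.isCausal (hC : C.OfMoves) (hP : IsPosition P) (hU : IsClosedWorld U) :
    IsCausal u := by
  constructor
  · intro c x x' h
    rw [C.fac_apply, C.fac_apply] at h
    obtain h | h := eq_of_new (c := unop c) hC.mono_a (.inl rfl) h
    · omega
    · have := hC.mono_a 0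
      exact app_injective C.start.hom _ (app_injective (C.a 0) _ (eq_of_heq (Sigma.mk.inj h).2))
  · intro c μ μ' e e' f f' he he' hf hf' h
    obtain ⟨n, y, rfl, hy, key⟩ := hC.exists_stage hP he
    obtain ⟨k, y', rfl, hy', -⟩ := hC.exists_stage hP he'
    rw [← app_res, ← app_res] at h
    have h₁ := eq_of_new hC.mono_a (.inr fun hr => hf' ((hy'.mem_range_left _).1 hr)) h
    have h₂ := eq_of_new hC.mono_a (.inr fun hr => hf ((hy.mem_range_left _).1 hr)) h.symm
    obtain h₁ | h₁ := h₁
    · obtain h₂ | h₂ := h₂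
      · omega
      · have := congrArg Sigma.fst h₂
        dsimp only at this
        omega
    · obtain ⟨rfl, h₁⟩ := Sigma.mk.inj h₁
      cases key _ _ he'
      rw [hy.inj (fun h => hf h.1) (eq_of_heq h₁)]
  · intro c μ e f he hf p h
    obtain ⟨n, y, rfl, hy, -⟩ := hC.exists_stage hP he
    rw [← app_res, C.fac_apply] at h
    obtain h | h := eq_of_new hC.mono_a
      (.inr fun hr => hf ((hy.mem_range_left _).1 hr)) h.symm
    · omega
    · obtain ⟨rfl, h⟩ := Sigma.mk.inj h
      exact hf ((hy.mem_range_left _).1 ⟨_, eq_of_heq h⟩)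
  · intro c μ μ' e e' f f' he he' hf hf' h
    obtain ⟨n, y, rfl, hy, key⟩ := hC.exists_stage hP he
    obtain ⟨k, y', rfl, hy', -⟩ := hC.exists_stage hP he'
    rw [← app_res, ← app_res] at h
    have h₁ := eq_of_old hC.mono_b (fun hr => hf' ((hy'.mem_range_right _).1 hr)) h
    have h₂ := eq_of_old hC.mono_b (fun hr => hf ((hy.mem_range_right _).1 hr)) h.symm
    obtain h₁ | h₁ := h₁
    · obtain h₂ | h₂ := h₂
      · omega
      · have := congrArg Sigma.fst h₂
        dsimp only at this
        omega
    · obtain ⟨rfl, h₁⟩ := Sigma.mk.inj h₁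
      cases key _ _ he'
      rw [hy.inj (fun h => hf h.2) (eq_of_heq h₁)]
  · intro c x
    obtain ⟨n, y, rfl⟩ := C.exists_rep x
    exact hC.reached hP hU n y

end Composition

theorem IsPlay.isCausal {P U : Diagram} {u : P ⟶ U} (h : IsPlay u) (hU : IsClosedWorld U) :
    IsCausal u := by
  obtain ⟨hP, C, hC⟩ := h
  exact hC.isCausal hP hU

/-! ### Sequentialising causal diagrams -/

/-- A pointwise criterion for pushouts of diagrams along injections. -/
theorem isPushout_of_cover {A B Z W : Diagram} {i : A ⟶ B} {f : A ⟶ Z} {β : B ⟶ W} {ζ : Z ⟶ W}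
    (w : i ≫ β = f ≫ ζ) (hi : ∀ c, Function.Injective (i.app c))
    (hζ : ∀ c, Function.Injective (ζ.app c))
    (cover : ∀ c y, (∃ b, β.app c b = y) ∨ ∃ z, ζ.app c z = y)
    (sep : ∀ c b z, β.app c b = ζ.app c z → ∃ a, i.app c a = b)
    (inj : ∀ c b b', b ∉ Set.range (i.app c) → β.app c b = β.app c b' → b = b') :
    IsPushout i f β ζ := by
  have hc : ∀ c, IsPushout (i.app c) (f.app c) (β.app c) (ζ.app c) := by
    intro c
    have wc : ∀ a, β.app c (i.app c a) = ζ.app c (f.app c a) := fun a =>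
      ConcreteCategory.congr_hom (NatTrans.congr_app w c) a
    have := (mono_iff_injective (ζ.app c)).2 (hζ c)
    refine (Types.isPushout_of_isPullback_of_mono' ?_ ?_ fun b b' hb _ h => inj c b b' hb h).flip
    · refine (Types.isPullback_iff _ _ _ _).2 ⟨?_, fun a a' h => hi c h.2, fun z b h => ?_⟩
      · ext a
        exact (wc a).symm
      · obtain ⟨a, rfl⟩ := sep c b z h.symm
        exact ⟨a, hζ c ((wc a).symm.trans h.symm), rfl⟩
    · refine Set.eq_univ_of_forall fun y => ?_
      obtain h | h := cover c y
      · exact .inr h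
      · exact .inl h
  have hp := IsPushout.of_hasPushout i f
  let φ : pushout i f ⟶ W := pushout.desc β ζ w
  have hφ : ∀ c, IsIso (φ.app c) := by
    intro c
    have : φ.app c = ((isPushout_app hp c).isoIsPushout _ _ (hc c)).hom := by
      apply (isPushout_app hp c).hom_ext
      · rw [IsPushout.inl_isoIsPushout_hom, ← NatTrans.comp_app, pushout.inl_desc]
      · rw [IsPushout.inr_isoIsPushout_hom, ← NatTrans.comp_app, pushout.inr_desc]
    rw [this]
    infer_instance
  have := NatIso.isIso_of_isIso_app φ
  exact IsPushout.of_iso hp (Iso.refl _) (Iso.refl _) (Iso.refl _) (asIso φ) (by simp) (by simp)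
    (by simpa using pushout.inl_desc _ _ w) (by simpa using pushout.inr_desc _ _ w)

/-- The map into a subdiagram `W` given by restrictions of an element `e`. -/
def along {U B : Diagram} {μ : Move} (e : U.obj (op (move μ))) (W : Subfunctor U)
    (j : B ⟶ μ.diagram) (h : ∀ (c : Obj) (x : B.obj (op c)),
      res (j.app (op c) x) e ∈ W.obj (op c)) : B ⟶ W.toFunctor where
  app c := ↾fun x => ⟨res (c := unop c) (j.app c x) e, h (unop c) x⟩
  naturality c d f := by
    ext x
    apply Subtype.ext
    change res (c := unop d) (j.app d (B.map f x)) e = res f.unop (res (c := unop c) (j.app c x) e)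
    rw [res_res, NatTrans.naturality_apply]
    rfl

/-- The pushouts occurring in an extended move inside a fixed diagram `U`: `W` is the union of `Z`
and of the image of `B`, and the two only share the interface of the move. -/
theorem isPushout_along {U B : Diagram} {μ : Move} {e : U.obj (op (move μ))} {Z W : Subfunctor U}
    (i : μ.interface.toFunctor ⟶ B) (j : B ⟶ μ.diagram) (hij : i ≫ j = μ.interface.ι)
    (hj : ∀ c, Function.Injective (j.app c))
    (hI : ∀ (c : Obj) (x : μ.interface.toFunctor.obj (op c)),
      res (μ.interface.ι.app (op c) x) e ∈ Z.obj (op c))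
    (hB : ∀ (c : Obj) (x : B.obj (op c)), res (j.app (op c) x) e ∈ W.obj (op c)) (hZW : Z ≤ W)
    (cover : ∀ (c : Obj), ∀ x ∈ W.obj (op c), (∃ b, res (j.app (op c) b) e = x) ∨ x ∈ Z.obj (op c))
    (sep : ∀ (c : Obj) b, res (j.app (op c) b) e ∈ Z.obj (op c) →
      j.app (op c) b ∈ μ.interface.obj (op c))
    (inj : ∀ {c : Obj} {f f' : c ⟶ move μ}, f ∉ μ.interface.obj (op c) → res f e = res f' e →
      f = f') :
    IsPushout i (along e Z μ.interface.ι hI) (along e W j hB) (Subfunctor.homOfLe hZW) := by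
  have hij' : ∀ c x, j.app c (i.app c x) = x.1 := fun c x =>
    ConcreteCategory.congr_hom (NatTrans.congr_app hij c) x
  have mem : ∀ c b, j.app c b ∈ μ.interface.obj c → b ∈ Set.range (i.app c) := fun c b hb =>
    ⟨⟨_, hb⟩, hj c (hij' c _)⟩
  refine isPushout_of_cover ?_ ?_ ?_ ?_ ?_ ?_
  · ext c x
    exact Subtype.ext (congrArg (fun f => res (c := unop c) f e) (hij' c x))
  · intro c x y h
    have := congrArg (j.app c) h
    rw [hij', hij'] at this
    exact Subtype.ext this
  · intro c x y h
    have := congrArg Subtype.val h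
    exact Subtype.ext this
  · intro c y
    obtain ⟨b, hb⟩ | h := cover (unop c) y.1 y.2
    · exact .inl ⟨b, Subtype.ext hb⟩
    · exact .inr ⟨⟨_, h⟩, rfl⟩
  · intro c b z h
    refine mem c b (sep (unop c) b ?_)
    have : res (c := unop c) (j.app c b) e = z.1 := congrArg Subtype.val h
    rw [this]
    exact z.2
  · intro c b b' hb h
    exact hj c (inj (c := unop c) (fun h => hb (mem c b h)) (congrArg Subtype.val h))

/-- The events of a diagram. -/
abbrev Event (U : Diagram) : Type := Σ μ : Move, {e : U.obj (op (move μ)) // IsEvent e}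

section

variable {X U : Diagram} (u : X ⟶ U)

/-- The elements which are present once the events of `S` have been played. -/
def Past (S : Set (Event U)) {c : Obj} (x : U.obj (op c)) : Prop :=
  (∃ p, u.app _ p = x) ∨ ∃ e ∈ S, ∃ f : c ⟶ move e.1, f ∉ e.1.initial.obj (op c) ∧ res f e.2.1 = x

/-- The moves of `S`, and the players which have been consumed by them. -/
def Consumed (S : Set (Event U)) {c : Obj} (x : U.obj (op c)) : Prop :=
  ∃ e ∈ S, ∃ f : c ⟶ move e.1, f ∉ e.1.final.obj (op c) ∧ res f e.2.1 = x

/-- An event can be played after `S` when its initial position is there. -/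
def Enabled (S : Set (Event U)) (e : Event U) : Prop :=
  ∀ {c : Obj} (f : c ⟶ move e.1), f ∈ e.1.initial.obj (op c) → Past u S (res f e.2.1)

/-- A set of events contains the causes of its elements. -/
def Admissible (S : Set (Event U)) : Prop := ∀ e ∈ S, Enabled u S e

/-- The set of events played after attempting to play `o`. -/
def next (S : Set (Event U)) (o : Option (Event U)) : Set (Event U) :=
  S ∪ {e | o = some e ∧ Enabled u S e}

/-- The set of events played after `n` attempts, following the schedule `g`. -/
def played (g : ℕ → Option (Event U)) : ℕ → Set (Event U)
  | 0 => ∅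
  | n + 1 => next u (played g n) (g n)

variable {u} {S S' : Set (Event U)} {c : Obj}

theorem Past.mono (h : S ⊆ S') {x : U.obj (op c)} (hx : Past u S x) : Past u S' x :=
  hx.imp_right fun ⟨e, he, hf⟩ => ⟨e, h he, hf⟩

theorem Consumed.mono (h : S ⊆ S') {x : U.obj (op c)} (hx : Consumed S x) : Consumed S' x := by
  obtain ⟨e, he, hf⟩ := hx
  exact ⟨e, h he, hf⟩

theorem Enabled.mono (h : S ⊆ S') {e : Event U} (he : Enabled u S e) : Enabled u S' e :=
  fun f hf => (he f hf).mono h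

theorem not_consumed_chan {x : U.obj (op chan)} : ¬ Consumed S x := by
  rintro ⟨e, -, f, hf, -⟩
  exact hf (chan_mem_final f)

theorem Admissible.past (hS : Admissible u S) {e : Event U} (he : e ∈ S) (f : c ⟶ move e.1) :
    Past u S (res f e.2.1) := by
  by_cases hf : f ∈ e.1.initial.obj (op c)
  · exact hS e he f hf
  · exact .inr ⟨e, he, f, hf, rfl⟩

theorem Admissible.past_res (hS : Admissible u S) {d : Obj} (g : d ⟶ c) {x : U.obj (op c)}
    (hx : Past u S x) : Past u S (res g x) := by
  obtain ⟨p, rfl⟩ | ⟨e, he, f, -, rfl⟩ := hx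
  · exact .inl ⟨_, app_res u g p⟩
  · rw [res_res]
    exact hS.past he _

theorem subset_next (S : Set (Event U)) (o : Option (Event U)) : S ⊆ next u S o :=
  Set.subset_union_left

/-- An attempt either changes nothing or plays a new enabled event. -/
theorem next_eq (S : Set (Event U)) (o : Option (Event U)) :
    next u S o = S ∨ ∃ e ∉ S, Enabled u S e ∧ next u S o = insert e S := by
  by_cases h : ∃ e ∉ S, o = some e ∧ Enabled u S e
  · obtain ⟨e, heS, rfl, he⟩ := h
    refine .inr ⟨e, heS, he, ?_⟩
    ext e'
    simp only [next, Set.mem_union, Set.mem_ofPred_eq, Option.some.injEq, Set.mem_insert_iff]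
    constructor
    · rintro (h | ⟨rfl, -⟩)
      exacts [.inr h, .inl rfl]
    · rintro (rfl | h)
      exacts [.inr ⟨rfl, he⟩, .inl h]
  · refine .inl (Set.union_eq_self_of_subset_right ?_)
    rintro e ⟨h₁, h₂⟩
    by_contra h₃
    exact h ⟨e, h₃, h₁, h₂⟩

theorem Admissible.next (hS : Admissible u S) (o : Option (Event U)) :
    Admissible u (next u S o) := by
  rintro e (he | ⟨-, he⟩)
  · exact Enabled.mono (subset_next S o) (hS e he)
  · exact Enabled.mono (subset_next S o) he

theorem admissible_played (g : ℕ → Option (Event U)) (n : ℕ) : Admissible u (played u g n) := by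
  induction n with
  | zero => exact fun e he => he.elim
  | succ n ih => exact ih.next _

theorem monotone_played (g : ℕ → Option (Event U)) : Monotone (played u g) :=
  monotone_nat_of_le_succ fun n => subset_next (played u g n) (g n)

/-- The position reached once the events of `S` have been played. -/
def frontier (hX : IsPosition X) (hS : Admissible u S) : Subfunctor U where
  obj c := {x : U.obj (op (unop c)) | Past u S x ∧ ¬ Consumed S x}
  map := by
    rintro ⟨c⟩ ⟨d⟩ g x ⟨hx, hx'⟩
    have hp := hS.past_res g.unop hx
    refine ⟨hp, ?_⟩
    obtain ⟨g, rfl⟩ : ∃ h, g = Quiver.Hom.op h := ⟨g.unop, rfl⟩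
    cases c with
    | chan =>
      change Hom _ _ at g
      cases g
      exact not_consumed_chan
    | player n =>
      change Hom _ _ at g
      cases g
      · exact fun h => hx' ((congrArg (Consumed S) (res_id (c := player n) x)).mp h)
      · exact not_consumed_chan
    | move μ =>
      obtain ⟨p, -⟩ | ⟨e, he, f, -, rfl⟩ := hx
      · exact ((hX.noMove μ).false p).elim
      · exact (hx' ⟨e, he, f, not_mem_span_move f, rfl⟩).elim

theorem isStatic_frontier (hX : IsPosition X) (hS : Admissible u S) :
    IsStatic (frontier hX hS).toFunctor := by
  refine fun μ => ⟨fun x => ?_⟩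
  obtain ⟨p, -⟩ | ⟨e, he, f, -, hf⟩ := x.2.1
  · exact (hX.noMove μ).false p
  · exact x.2.2 ⟨e, he, f, not_mem_span_move f, hf⟩

/-- Elements created by an event are not there before it is played. -/
theorem IsCausal.not_past (hu : IsCausal u) {e : Event U} (he : e ∉ S) {f : c ⟶ move e.1}
    (hf : f ∉ e.1.initial.obj (op c)) : ¬ Past u S (res f e.2.1) := by
  rintro (⟨p, hp⟩ | ⟨e', he', f', hf', h⟩)
  · exact hu.new_ne_base e.2.2 hf p hp.symm
  · have := hu.new_inj e'.2.2 e.2.2 hf' hf h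
    obtain ⟨μ, e, _⟩ := e
    obtain ⟨μ', e', _⟩ := e'
    cases this
    exact he he'

/-- Elements of the initial position of an event are not consumed before it is played. -/
theorem IsCausal.not_consumed (hu : IsCausal u) {e : Event U} (he : e ∉ S) {f : c ⟶ move e.1}
    (hf : f ∈ e.1.initial.obj (op c)) : ¬ Consumed S (res f e.2.1) := by
  cases c with
  | chan => exact not_consumed_chan
  | move ν => exact absurd hf (not_mem_span_move f)
  | player k =>
    rintro ⟨e', he', f', hf', h⟩
    have := hu.old_inj e'.2.2 e.2.2 hf' (mem_initial_player.1 hf).not_mem_final h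
    obtain ⟨μ, e, _⟩ := e
    obtain ⟨μ', e', _⟩ := e'
    cases this
    exact he he'

/-- Playing an enabled event is an extended move between frontiers. -/
theorem IsCausal.isExtendedMove (hu : IsCausal u) (hX : IsPosition X) {e : Event U} (he : e ∉ S)
    (hE : Enabled u S e) (hS : Admissible u S) (hS' : Admissible u S') (hSS' : S' = insert e S)
    {M : Subfunctor U} (hM : ∀ {c : Obj} (x : U.obj (op c)), x ∈ M.obj (op c) ↔
      x ∈ (frontier hX hS).obj (op c) ∨ ∃ f, res f e.2.1 = x)
    (h : frontier hX hS ≤ M) (h' : frontier hX hS' ≤ M) :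
    IsExtendedMove (Subfunctor.homOfLe h) (Subfunctor.homOfLe h') := by
  have old : ∀ {c : Obj} (f : c ⟶ move e.1), f ∈ e.1.initial.obj (op c) →
      res f e.2.1 ∈ (frontier hX hS).obj (op c) := fun f hf => ⟨hE f hf, hu.not_consumed he hf⟩
  have past_iff : ∀ {c : Obj} (f : c ⟶ move e.1),
      Past u S (res f e.2.1) ↔ f ∈ e.1.initial.obj (op c) := fun f =>
    ⟨fun hp => by_contra fun hf => hu.not_past he hf hp, hE f⟩
  -- `e` identifies at most channels: new elements are told apart by `new_inj`, consumed ones by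
  -- `old_inj`, and the two kinds are separated by `Past`.
  have inj : ∀ {c : Obj} {f f' : c ⟶ move e.1}, f ∉ e.1.interface.obj (op c) →
      res f e.2.1 = res f' e.2.1 → f = f' := by
    intro c f f' hf h
    by_cases hi : f ∈ e.1.initial.obj (op c)
    · have hf₂ : f ∉ e.1.final.obj (op c) := fun h => hf ⟨hi, h⟩
      have hi' : f' ∈ e.1.initial.obj (op c) := (past_iff f').1 (h ▸ hE f hi)
      have hf₂' : f' ∉ e.1.final.obj (op c) := by
        intro hf'
        cases mem_interface ⟨hi', hf'⟩
        exact hf₂ (chan_mem_final f)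
      have := hu.old_inj e.2.2 e.2.2 hf₂ hf₂' h
      exact (Prod.mk.inj (eq_of_heq (Sigma.mk.inj this).2)).2
    · have hi' : f' ∉ e.1.initial.obj (op c) := fun hi' =>
        hi ((past_iff f).1 (h.symm ▸ hE f' hi'))
      have := hu.new_inj e.2.2 e.2.2 hi hi' h
      exact (Prod.mk.inj (eq_of_heq (Sigma.mk.inj this).2)).2
  -- The position `Z` consists of what `e` does not consume.
  let Z : Subfunctor U := frontier hX hS ⊓ frontier hX hS'
  have memZ : ∀ {c : Obj} (x : U.obj (op c)), x ∈ Z.obj (op c) ↔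
      x ∈ (frontier hX hS).obj (op c) ∧ ∀ f, res f e.2.1 = x → f ∈ e.1.final.obj (op c) := by
    intro c x
    constructor
    · rintro ⟨h₁, h₂⟩
      refine ⟨h₁, fun f hf => by_contra fun hf' => h₂.2 ⟨e, ?_, f, hf', hf⟩⟩
      exact hSS' ▸ Set.mem_insert e S
    · rintro ⟨h₁, h₂⟩
      refine ⟨h₁, h₁.1.mono (hSS' ▸ Set.subset_insert e S), ?_⟩
      rintro ⟨e', he', f, hf, rfl⟩
      rw [hSS'] at he'
      obtain rfl | he' := he'
      · exact hf (h₂ f rfl)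
      · exact h₁.2 ⟨e', he', f, hf, rfl⟩
  have sepZ : ∀ {c : Obj} (f : c ⟶ move e.1), res f e.2.1 ∈ Z.obj (op c) →
      f ∈ e.1.interface.obj (op c) := fun f hf =>
    ⟨(past_iff f).1 hf.1.1, ((memZ _).1 hf).2 f rfl⟩
  have interfaceZ : ∀ {c : Obj} (f : c ⟶ move e.1), f ∈ e.1.interface.obj (op c) →
      res f e.2.1 ∈ Z.obj (op c) := by
    intro c f hf
    cases mem_interface hf
    exact (memZ _).2 ⟨old f hf.1, fun f' _ => chan_mem_final f'⟩
  have final : ∀ {c : Obj} (f : c ⟶ move e.1), f ∈ e.1.final.obj (op c) →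
      res f e.2.1 ∈ (frontier hX hS').obj (op c) := by
    intro c f hf
    by_cases hi : f ∈ e.1.initial.obj (op c)
    · exact (interfaceZ f ⟨hi, hf⟩).2
    refine ⟨hS'.past (hSS' ▸ Set.mem_insert e S) f, ?_⟩
    rintro ⟨e', he', f', hf', h⟩
    have hf₁ : f' ∈ e'.1.initial.obj (op c) := by
      obtain ⟨ν, rfl⟩ | h := not_mem_final hf'
      · exact absurd hf (not_mem_span_move f)
      · exact h
    rw [hSS'] at he'
    obtain rfl | he' := he'
    · exact hi ((past_iff f).1 (h ▸ hE f' hf₁))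
    · exact hi ((past_iff f).1 (h ▸ hS e' he' f' hf₁))
  have final_cover : ∀ {c : Obj}, ∀ x ∈ (frontier hX hS').obj (op c),
      (∃ f ∈ e.1.final.obj (op c), res f e.2.1 = x) ∨ x ∈ Z.obj (op c) := by
    intro c x hx
    by_cases hf : ∃ f, res f e.2.1 = x
    · obtain ⟨f, rfl⟩ := hf
      refine .inl ⟨f, by_contra fun hf => hx.2 ⟨e, ?_, f, hf, rfl⟩, rfl⟩
      exact hSS' ▸ Set.mem_insert e S
    · obtain h | h := (hM x).1 (h' _ hx)
      · exact .inr ⟨h, hx⟩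
      · exact absurd h hf
  have initial_cover : ∀ {c : Obj}, ∀ x ∈ (frontier hX hS).obj (op c),
      (∃ f ∈ e.1.initial.obj (op c), res f e.2.1 = x) ∨ x ∈ Z.obj (op c) := by
    intro c x hx
    by_cases hf : ∃ f, res f e.2.1 = x
    · obtain ⟨f, rfl⟩ := hf
      exact .inl ⟨f, (past_iff f).1 hx.1, rfl⟩
    · exact .inr ((memZ x).2 ⟨hx, fun f h => absurd ⟨f, h⟩ hf⟩)
  have hZ : IsPosition Z.toFunctor := by
    refine ⟨fun μ => ⟨fun x => ((isStatic_frontier hX hS) μ).false ⟨x.1, x.2.1⟩⟩, fun c => ?_⟩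
    have := hu.countable hX
    refine Function.Injective.countable (β := Σ c, U.obj (op c)) (f := fun x => ⟨c, x.1⟩) ?_
    intro x y h
    exact Subtype.ext (eq_of_heq (Sigma.mk.inj h).2)
  have hI : ∀ (c : Obj) (x : e.1.interface.toFunctor.obj (op c)),
      res (e.1.interface.ι.app (op c) x) e.2.1 ∈ Z.obj (op c) := fun c x => interfaceZ x.1 x.2
  refine ⟨e.1, Z.toFunctor, along e.2.1 Z e.1.interface.ι hI,
    along e.2.1 _ e.1.initial.ι fun c x => old x.1 x.2, Subfunctor.homOfLe inf_le_left,
    along e.2.1 M (𝟙 _) fun c x => (hM _).2 (.inr ⟨x, rfl⟩),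
    Subfunctor.homOfLe (inf_le_left.trans h),
    along e.2.1 _ e.1.final.ι fun c x => final x.1 x.2, Subfunctor.homOfLe inf_le_right,
    hZ, ?_, ?_, ?_, rfl, rfl, rfl, rfl⟩
  · refine isPushout_along _ _ rfl (fun c x y h => Subtype.ext h) _ _ _ ?_
      (fun c b hb => sepZ _ hb) inj
    intro c x hx
    obtain ⟨f, hf, rfl⟩ | h := initial_cover x hx
    exacts [.inl ⟨⟨f, hf⟩, rfl⟩, .inr h]
  · refine isPushout_along _ _ (Category.comp_id _) (fun c x y h => h) _ _ _ ?_
      (fun c b hb => sepZ _ hb) inj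
    intro c x hx
    obtain h | ⟨f, rfl⟩ := (hM x).1 hx
    · obtain ⟨f, hf, rfl⟩ | h := initial_cover x h
      exacts [.inl ⟨f, rfl⟩, .inr h]
    · exact .inl ⟨f, rfl⟩
  · refine isPushout_along _ _ rfl (fun c x y h => Subtype.ext h) _ _ _ ?_
      (fun c b hb => sepZ _ hb) inj
    intro c x hx
    obtain ⟨f, hf, rfl⟩ | h := final_cover x hx
    exacts [.inl ⟨⟨f, hf⟩, rfl⟩, .inr h]

end

section

variable {X U : Diagram} {u : X ⟶ U} {S : Set (Event U)} {c : Obj}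

/-- The diagram of an attempt to play an event: the frontiers before and after it, and the event
itself if it has been played. -/
def attempt (hX : IsPosition X) (hS : Admissible u S) (o : Option (Event U)) : Subfunctor U where
  obj c := {x : U.obj (op (unop c)) | x ∈ (frontier hX hS).obj c ∨
    ∃ e ∈ next u S o, e ∉ S ∧ ∃ f : unop c ⟶ move e.1, res f e.2.1 = x}
  map := by
    rintro c d g x (hx | ⟨e, he, he', f, rfl⟩)
    · exact .inl ((frontier hX hS).map g hx)
    · exact .inr ⟨e, he, he', g.unop ≫ f, (res_res _ _ _).symm⟩

theorem mem_attempt {hX : IsPosition X} {hS : Admissible u S} {o : Option (Event U)}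
    {x : U.obj (op c)} : x ∈ (attempt hX hS o).obj (op c) ↔ x ∈ (frontier hX hS).obj (op c) ∨
      ∃ e ∈ next u S o, e ∉ S ∧ ∃ f : c ⟶ move e.1, res f e.2.1 = x := Iff.rfl

variable (hX : IsPosition X) (hS : Admissible u S) (o : Option (Event U))

theorem frontier_le_attempt : frontier hX hS ≤ attempt hX hS o := fun _ _ h => .inl h

theorem frontier_next_le_attempt : frontier hX (hS.next o) ≤ attempt hX hS o := by
  rintro ⟨c⟩ x ⟨hx, hx'⟩
  by_cases h : Past u S x
  · exact .inl ⟨h, fun hc => hx' (hc.mono (subset_next S o))⟩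
  · obtain hp | ⟨e, he, f, hf, hfx⟩ := hx
    · exact (h (.inl hp)).elim
    · refine .inr ⟨e, he, fun heS => h (.inr ⟨e, heS, f, hf, hfx⟩), f, hfx⟩

theorem past_of_mem_attempt {x : U.obj (op c)} (hx : x ∈ (attempt hX hS o).obj (op c)) :
    Past u (next u S o) x := by
  obtain hx | ⟨e, he, -, f, rfl⟩ := hx
  · exact hx.1.mono (subset_next S o)
  · exact (hS.next o).past he f

theorem mem_attempt_of_past {x : U.obj (op c)} (hx : Past u (next u S o) x)
    (hx' : ¬ Past u S x) : x ∈ (attempt hX hS o).obj (op c) := by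
  obtain hp | ⟨e, he, f, hf, rfl⟩ := hx
  · exact (hx' (.inl hp)).elim
  · exact .inr ⟨e, he, fun heS => hx' (hS.past heS f), f, rfl⟩

/-- The only elements of an attempt outside the frontier preceding it are new ones. -/
theorem IsCausal.mem_frontier_of_mem_attempt (hu : IsCausal u) {x : U.obj (op c)}
    (hx : x ∈ (attempt hX hS o).obj (op c)) (hx' : Past u S x) :
    x ∈ (frontier hX hS).obj (op c) := by
  obtain hx | ⟨e, he, heS, f, rfl⟩ := hx
  · exact hx
  · exact ⟨hx', hu.not_consumed heS (by_contra fun hf => hu.not_past heS hf hx')⟩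

theorem isIso_homOfLe {A B : Subfunctor U} (h : A ≤ B) (h' : B ≤ A) :
    IsIso (Subfunctor.homOfLe h) :=
  ⟨Subfunctor.homOfLe h', rfl, rfl⟩

theorem IsCausal.isExtendedMove_or_isIdle (hu : IsCausal u) :
    IsExtendedMove (Subfunctor.homOfLe (frontier_le_attempt hX hS o))
      (Subfunctor.homOfLe (frontier_next_le_attempt hX hS o)) ∨
    IsIdle (Subfunctor.homOfLe (frontier_le_attempt hX hS o))
      (Subfunctor.homOfLe (frontier_next_le_attempt hX hS o)) := by
  obtain h | ⟨e, he, hE, h⟩ := next_eq S o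
  · right
    have le : attempt hX hS o ≤ frontier hX hS := by
      rintro c x (hx | ⟨e, he, heS, -⟩)
      · exact hx
      · exact (heS (h ▸ he)).elim
    refine ⟨isIso_homOfLe _ le, isIso_homOfLe _ (le.trans ?_)⟩
    rintro c x ⟨hx, hx'⟩
    exact ⟨hx.mono (subset_next S o), h.symm ▸ hx'⟩
  · left
    refine hu.isExtendedMove hX he hE hS (hS.next o) h (fun x => ?_) _ _
    rw [mem_attempt, h]
    refine or_congr_right ⟨?_, fun hf => ⟨e, Set.mem_insert e S, he, hf⟩⟩
    rintro ⟨e', rfl | he', heS, hf⟩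
    · exact hf
    · exact (heS he').elim

end

/-- A move involves players knowing boundedly many channels. -/
theorem exists_bound_player (μ : Move) : ∃ B, ∀ {k : ℕ}, (player k ⟶ move μ) → k < B := by
  rcases μ with b | n | ⟨n, i, m, j⟩
  · refine ⟨b.src + b.tgt + 1, fun {k} f => ?_⟩
    change Hom _ _ at f
    cases f <;> omega
  · refine ⟨n + 1, fun {k} f => ?_⟩
    change Hom _ _ at f
    cases f <;> omega
  · refine ⟨n + m + 1, fun {k} f => ?_⟩
    change Hom _ _ at f
    cases f <;> omega

/-- A fair schedule attempts to play every event infinitely often. -/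
def IsFair {U : Diagram} (g : ℕ → Option (Event U)) : Prop := ∀ e N, ∃ n, N ≤ n ∧ g n = some e

theorem exists_isFair {U : Diagram} [Countable (Event U)] :
    ∃ g : ℕ → Option (Event U), IsFair g := by
  obtain ⟨s, hs⟩ := exists_surjective_nat (Option (Event U))
  refine ⟨fun n => s n.unpair.1, fun e N => ?_⟩
  obtain ⟨k, hk⟩ := hs (some e)
  exact ⟨Nat.pair k N, Nat.right_le_pair k N, by simpa using hk⟩

section

variable {X U : Diagram} {u : X ⟶ U} {g : ℕ → Option (Event U)}

/-- A fair schedule eventually plays everything. -/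
theorem Reached.exists_past (hg : IsFair g) {c : Obj} {x : U.obj (op c)} (h : Reached u x) :
    ∃ n, Past u (played u g n) x := by
  induction h with
  | base p => exact ⟨0, .inl ⟨p, rfl⟩⟩
  | @step μ hμ e _ c f ih =>
    obtain ⟨B, hB⟩ := exists_bound_player μ
    choose N hN using fun i : Σ k : Fin B, {f : player k.1 ⟶ move μ // IsInitial f} =>
      ih i.2.1 i.2.2
    obtain ⟨N₀, hN₀⟩ := Finite.exists_le N
    -- The event containing `e` has no other initial players than `e`, so it becomes enabled too.
    obtain ⟨ν, i, e', he', rfl⟩ := exists_isEvent e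
    obtain ⟨n, hn, hgn⟩ := hg ⟨ν, e', he'⟩ N₀
    have hen : Enabled u (played u g n) ⟨ν, e', he'⟩ := by
      intro d f' hf'
      obtain ⟨f', ⟨k, p, j, hp, rfl⟩, rfl⟩ := hμ.mem_initial i hf'
      have : Past u (played u g n) (res p (res i e')) :=
        (hN ⟨⟨k, hB p⟩, p, hp⟩).mono (monotone_played g ((hN₀ _).trans hn))
      have := (admissible_played g n).past_res j this
      rwa [res_res, res_res] at this
    have hmem : (⟨ν, e', he'⟩ : Event U) ∈ played u g (n + 1) := .inr ⟨hgn, hen⟩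
    refine ⟨n + 1, ?_⟩
    rw [res_res]
    exact (admissible_played g (n + 1)).past hmem (f ≫ i)

variable (u g) in
/-- The position reached after `n` attempts. -/
abbrev stagePosition (hX : IsPosition X) (n : ℕ) : Subfunctor U :=
  frontier hX (admissible_played (u := u) g n)

variable (u g) in
/-- The diagram of the `n`-th attempt. -/
abbrev stageMove (hX : IsPosition X) (n : ℕ) : Subfunctor U :=
  attempt hX (admissible_played (u := u) g n) (g n)

/-- Every element of `U` occurs in the attempt which first makes it past. -/
theorem exists_mem_stageMove (hX : IsPosition X) (hu : IsCausal u) (hg : IsFair g) {c : Obj}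
    (x : U.obj (op c)) : ∃ n, x ∈ (stageMove u g hX n).obj (op c) := by
  classical
  have h := (hu.reached x).exists_past hg
  obtain hn | ⟨n, hn⟩ : Nat.find h = 0 ∨ ∃ n, Nat.find h = n + 1 := by
    cases Nat.find h <;> simp
  · refine ⟨0, .inl ⟨hn ▸ Nat.find_spec h, ?_⟩⟩
    rintro ⟨e, he, -⟩
    exact he
  · have hs := Nat.find_spec h
    rw [hn] at hs
    exact ⟨n, mem_attempt_of_past hX _ _ hs (Nat.find_min h (by omega))⟩

/-- An element present at two stages stays in the frontier in between. -/
theorem mem_stagePosition (hX : IsPosition X) (hu : IsCausal u) {c : Obj} {x : U.obj (op c)}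
    {n k j : ℕ} (hn : x ∈ (stageMove u g hX n).obj (op c))
    (hk : x ∈ (stageMove u g hX k).obj (op c)) (hnj : n < j) (hjk : j ≤ k) :
    x ∈ (stagePosition u g hX j).obj (op c) := by
  have hp : ∀ j, n < j → Past u (played u g j) x := fun j hj =>
    (past_of_mem_attempt hX _ _ hn).mono (monotone_played g hj)
  have hk' := hu.mem_frontier_of_mem_attempt hX _ _ hk (hp k (by omega))
  exact ⟨hp j hnj, fun hc => hk'.2 (hc.mono (monotone_played g hjk))⟩

/-- The presentation of a causal diagram as a composition of cospans following a fair schedule. -/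
noncomputable def IsCausal.composition (hu : IsCausal u) (hX : IsPosition X) (hg : IsFair g) :
    Composition u where
  X n := (stagePosition u g hX n).toFunctor
  M n := (stageMove u g hX n).toFunctor
  a n := Subfunctor.homOfLe (frontier_le_attempt hX _ _)
  b n := Subfunctor.homOfLe (frontier_next_le_attempt hX (admissible_played g n) _)
  m n := (stageMove u g hX n).ι
  start :=
    have hmem : ∀ (c : Obj) (p : X.obj (op c)),
        u.app (op c) p ∈ (stagePosition u g hX 0).obj (op c) := fun c p =>
      ⟨.inl ⟨p, rfl⟩, fun ⟨_, he, _⟩ => he⟩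
    let φ : X ⟶ (stagePosition u g hX 0).toFunctor :=
      { app c := ↾fun p => ⟨u.app c p, hmem (unop c) p⟩
        naturality c d f := by
          ext p
          have := NatTrans.naturality_apply u f p
          exact Subtype.ext this }
    have : ∀ c, IsIso (φ.app c) := by
      refine fun c => (isIso_iff_bijective _).2 ⟨fun p q h => ?_, fun x => ?_⟩
      · have := congrArg Subtype.val h
        exact hu.base_inj c this
      · obtain ⟨p, hp⟩ | ⟨e, he, -⟩ := x.2.1
        · exact ⟨p, Subtype.ext hp⟩
        · exact he.elim
    have := NatIso.isIso_of_isIso_app φ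
    asIso φ
  fac := rfl
  glue n := rfl
  desc T t ht := by
    have htn : ∀ n {c : Obj} (x : U.obj (op c)) (h : x ∈ (stagePosition u g hX (n + 1)).obj (op c)),
        (t n).app (op c) ⟨x, frontier_next_le_attempt hX (admissible_played g n) _ _ h⟩ =
          (t (n + 1)).app (op c) ⟨x, frontier_le_attempt hX _ _ _ h⟩ := fun n c x h =>
      ConcreteCategory.congr_hom (NatTrans.congr_app (ht n) (op c))
        (⟨x, h⟩ : (stagePosition u g hX (n + 1)).toFunctor.obj (op c))
    have lt : ∀ {c : Obj} (x : U.obj (op c)) (n k : ℕ) (hnk : n ≤ k)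
        (hn : x ∈ (stageMove u g hX n).obj (op c)) (hk : x ∈ (stageMove u g hX k).obj (op c)),
        (t n).app (op c) ⟨x, hn⟩ = (t k).app (op c) ⟨x, hk⟩ := by
      intro c x n k hnk hn
      induction k, hnk using Nat.le_induction with
      | base => exact fun _ => rfl
      | succ k hnk ih =>
        intro hk
        have h := mem_stagePosition hX hu hn hk (by omega : n < k + 1) le_rfl
        exact (ih (frontier_next_le_attempt hX (admissible_played g k) _ _ h)).trans (htn k x h)
    have eq : ∀ {c : Obj} (x : U.obj (op c)) (n k : ℕ)
        (hn : x ∈ (stageMove u g hX n).obj (op c)) (hk : x ∈ (stageMove u g hX k).obj (op c)),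
        (t n).app (op c) ⟨x, hn⟩ = (t k).app (op c) ⟨x, hk⟩ := by
      intro c x n k hn hk
      obtain h | h := le_total n k
      · exact lt x n k h hn hk
      · exact (lt x k n h hk hn).symm
    -- By `eq`, the value at `x` of the induced map can be read off at any stage containing `x`.
    choose N hN using fun (c : Obj) (x : U.obj (op c)) => exists_mem_stageMove hX hu hg x
    let v : U ⟶ T :=
      { app c := ↾fun x => (t (N (unop c) x)).app c ⟨x, hN (unop c) x⟩
        naturality c d f := by
          ext x
          have h := (stageMove u g hX (N (unop c) x)).map f (hN (unop c) x)
          refine (eq (c := unop d) (U.map f x) _ _ (hN (unop d) _) h).trans ?_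
          exact NatTrans.naturality_apply (t (N (unop c) x)) f ⟨x, hN (unop c) x⟩ }
    refine ⟨v, fun n => ?_, fun v' hv' => ?_⟩
    · ext c x
      exact eq (c := unop c) x.1 _ _ _ x.2
    · ext c x
      exact ConcreteCategory.congr_hom (NatTrans.congr_app (hv' (N (unop c) x)) c)
        ⟨x, hN (unop c) x⟩

/-- Causal diagrams are plays. -/
theorem IsCausal.isPlay (hu : IsCausal u) (hX : IsPosition X) : IsPlay u := by
  have := hu.countable hX
  have : Countable (Event U) := by
    refine Function.Injective.countable (β := Σ c, U.obj (op c))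
      (f := fun e => ⟨move e.1, e.2.1⟩) ?_
    rintro ⟨μ, e, _⟩ ⟨μ', e', _⟩ h
    cases h
    rfl
  obtain ⟨g, hg⟩ := exists_isFair (U := U)
  exact ⟨hX, hu.composition hX hg, fun n => hu.isExtendedMove_or_isIdle hX _ _⟩

end

/-! ### Views are finite -/

theorem finite_sources (d : Obj) : {c : Obj | Nonempty (c ⟶ d)}.Finite := by
  obtain ⟨B, hB⟩ : ∃ B, ∀ {k : ℕ}, (player k ⟶ d) → k < B := by
    cases d with
    | chan => exact ⟨0, fun f => by change Hom _ _ at f; cases f⟩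
    | player n => exact ⟨n + 1, fun f => by change Hom _ _ at f; cases f; omega⟩
    | move μ => exact exists_bound_player μ
  let T : Set Obj := match d with
    | move (fork n) => {move (basic (.parL n)), move (basic (.parR n))}
    | move (sync n i m j) => {move (basic (.out n i)), move (basic (.inp m j))}
    | _ => ∅
  have hT : T.Finite := by
    unfold T
    split <;> simp
  refine (((Set.toFinite {d, chan}).union ((Set.finite_Iio B).image player)).union hT).subset ?_
  rintro (_ | k | ν) ⟨f⟩
  · exact .inl (.inl (.inr rfl))
  · exact .inl (.inr ⟨k, hB f, rfl⟩)
  · change Hom _ _ at f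
    cases f with
    | id => exact .inl (.inl (.inl rfl))
    | forkL n => exact .inr (.inl rfl)
    | forkR n => exact .inr (.inr rfl)
    | syncOut i j => exact .inr (.inl rfl)
    | syncInp i j => exact .inr (.inr rfl)

/-- Diagrams with finitely many elements. -/
def IsFiniteDiagram (U : Diagram) : Prop := Finite (Σ c, U.obj (op c))

theorem isFiniteDiagram_yoneda (d : Obj) : IsFiniteDiagram (yoneda.obj d) := by
  have := (finite_sources d).to_subtype
  refine Finite.of_injective (β := Σ c : {c : Obj | Nonempty (c ⟶ d)}, (c.1 ⟶ d))
    (fun x => ⟨⟨x.1, ⟨x.2⟩⟩, x.2⟩) ?_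
  rintro ⟨c, f⟩ ⟨c', f'⟩ h
  cases h
  rfl

theorem IsFiniteDiagram.of_mono {U V : Diagram} (h : IsFiniteDiagram V) (k : U ⟶ V) [Mono k] :
    IsFiniteDiagram U := by
  have : Finite (Σ c, V.obj (op c)) := h
  refine Finite.of_injective (β := Σ c, V.obj (op c)) (fun x => ⟨x.1, k.app _ x.2⟩) ?_
  rintro ⟨c, x⟩ ⟨c', x'⟩ h
  obtain ⟨rfl, h⟩ := Sigma.mk.inj h
  exact Sigma.ext rfl (heq_of_eq (app_injective k _ (eq_of_heq h)))

theorem Composition.OfBasicMoves.isFiniteDiagram {P U : Diagram} {u : P ⟶ U} {C : Composition u}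
    (hC : C.OfBasicMoves) (hP : IsFiniteDiagram P) (n : ℕ) : IsFiniteDiagram (C.M n) := by
  have step : ∀ n, IsFiniteDiagram (C.X n) → IsFiniteDiagram (C.M n) := by
    intro n h
    obtain ⟨β, -, m, -⟩ | ⟨ha, _⟩ := hC n
    · exact (isFiniteDiagram_yoneda _).of_mono m.inv
    · exact h.of_mono (inv (C.a n))
  induction n with
  | zero => exact step 0 (hP.of_mono C.start.inv)
  | succ n ih =>
    refine step (n + 1) ?_
    have : Mono (C.b n) := by
      obtain ⟨β, x, m, y, -, h⟩ | ⟨_, hb⟩ := hC n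
      · rw [← Iso.eq_inv_comp] at h
        rw [h]
        infer_instance
      · infer_instance
    exact ih.of_mono (C.b n)

/-- Only the stages up to the last basic move contribute elements to a view. -/
theorem IsView.isFiniteDiagram {P U : Diagram} {u : P ⟶ U} (h : IsView u) :
    IsFiniteDiagram U := by
  obtain ⟨⟨n, ⟨i⟩⟩, C, hC, N, hN⟩ := h
  have hM := hC.isFiniteDiagram ((isFiniteDiagram_yoneda (player n)).of_mono i.inv)
  let E : ℕ → Set (Σ c, U.obj (op c)) := fun n =>
    Set.range fun y : Σ c, (C.M n).obj (op c) => ⟨y.1, (C.m n).app _ y.2⟩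
  have hE : ∀ n, (E n).Finite := fun n =>
    have : Finite (Σ c, (C.M n).obj (op c)) := hM n
    Set.finite_range _
  have hsub : ∀ n, N ≤ n → E n ⊆ E N := by
    intro n hn
    induction n, hn using Nat.le_induction with
    | base => exact subset_rfl
    | succ n hn ih =>
      refine subset_trans ?_ ih
      rintro _ ⟨⟨c, y⟩, rfl⟩
      have := (hN (n + 1) (by omega)).1
      obtain ⟨z, rfl⟩ := app_surjective (C.a (n + 1)) _ y
      refine ⟨⟨c, (C.b n).app _ z⟩, Sigma.ext rfl (heq_of_eq ?_)⟩
      exact ConcreteCategory.congr_hom (NatTrans.congr_app (C.glue n) _) z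
  refine Set.finite_univ_iff.1 (((Set.finite_le_nat N).biUnion fun n _ => hE n).subset ?_)
  rintro ⟨c, x⟩ -
  obtain ⟨n, y, rfl⟩ := C.exists_rep x
  have hx : (⟨c, (C.m n).app _ y⟩ : Σ c, U.obj (op c)) ∈ E n := ⟨⟨c, y⟩, rfl⟩
  refine Set.mem_biUnion (x := min n N) (min_le_right n N) ?_
  obtain h | h := le_total n N
  · rwa [min_eq_left h]
  · rw [min_eq_right h]
    exact hsub n h hx

/-! ### Unions of sequences of closed-world plays -/

/-- A map whose values lie in the range of a monomorphism factors through it. -/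
theorem exists_factor {V U L : Diagram} (k : V ⟶ L) (ι : U ⟶ L) [Mono ι]
    (h : ∀ (c : Obj) (x : V.obj (op c)), k.app _ x ∈ Set.range (ι.app (op c))) :
    ∃ k' : V ⟶ U, k' ≫ ι = k := by
  choose s hs using h
  refine ⟨{ app := fun c => ↾(s (unop c)), naturality := fun c d f => ?_ }, ?_⟩
  · ext x
    refine app_injective ι d ((hs (unop d) (V.map f x)).trans ?_)
    have h₁ := NatTrans.naturality_apply k f x
    have h₂ := NatTrans.naturality_apply ι f (s (unop c) x)
    exact h₁.trans ((congrArg (L.map f) (hs (unop c) x)).symm.trans h₂.symm)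
  · ext c x
    exact hs (unop c) x

/-- A closed-world play which is the increasing union of a sequence of closed-world plays. -/
structure IsUnion {X : Diagram} (U : ℕ → ClosedPlay X) (i : ∀ n, U n ⟶ U (n + 1))
    (L : ClosedPlay X) (ι : ∀ n, U n ⟶ L) : Prop where
  w : ∀ n, i n ≫ ι (n + 1) = ι n
  cover : ∀ (c : Objᵒᵖ) (x : L.total.obj c), ∃ n y, (ClosedPlay.Hom.k (ι n)).app c y = x

/-- Increasing sequences of closed-world plays have unions: the colimit of the diagrams is causal,
hence a play. -/
theorem exists_isUnion {X : Diagram} (hX : IsPosition X) (U : ℕ → ClosedPlay X)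
    (i : ∀ n, U n ⟶ U (n + 1)) : ∃ L ι, IsUnion U i L ι := by
  let k : ∀ n, (U n).total ⟶ (U (n + 1)).total := fun n => ClosedPlay.Hom.k (i n)
  let D : ℕ ⥤ Diagram := Functor.ofSequence k
  let L : Diagram := colimit D
  let κ : ∀ n, (U n).total ⟶ L := fun n => colimit.ι D n
  have hw : ∀ n, k n ≫ κ (n + 1) = κ n := by
    intro n
    rw [← Functor.ofSequence_map_homOfLE_succ k n]
    exact colimit.w D (homOfLE n.le_succ)
  have hk : ∀ n, Mono (k n) := fun n => ClosedPlay.Hom.mono_k (i n)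
  have hD : ∀ n m (f : n ⟶ m), Mono (D.map f) := by
    intro n m f
    obtain ⟨h⟩ : Nonempty (n ≤ m) := ⟨leOfHom f⟩
    induction m, h using Nat.le_induction with
    | base =>
      rw [Subsingleton.elim f (𝟙 n), D.map_id]
      infer_instance
    | succ m h ih =>
      rw [Subsingleton.elim f (homOfLE h ≫ homOfLE m.le_succ), D.map_comp]
      have : D.map (homOfLE m.le_succ) = k m := Functor.ofSequence_map_homOfLE_succ k m
      rw [this]
      exact @mono_comp _ _ _ _ _ _ (ih (homOfLE h)) (k m) (hk m)
  have hcol : ∀ c, IsColimit (((evaluation _ _).obj c).mapCocone (colimit.cocone D)) := fun c =>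
    isColimitOfPreserves _ (colimit.isColimit D)
  have hinj : ∀ n c, Function.Injective ((κ n).app c) := by
    intro n c x y h
    obtain ⟨m, f, h⟩ := (Types.FilteredColimit.isColimit_eq_iff' (hcol c) x y).1 h
    have := hD _ _ f
    exact app_injective (D.map f) c h
  have hs : ∀ c (x : L.obj c), ∃ n y, (κ n).app c y = x := fun c x =>
    Types.jointly_surjective_of_isColimit (hcol c) x
  let v : X ⟶ L := (U 0).emb ≫ κ 0
  have hv : ∀ n, (U n).emb ≫ κ n = v := by
    intro n
    induction n with
    | zero => rfl
    | succ n ih => rw [← ih, ← hw n, ← Category.assoc, ClosedPlay.Hom.triangle (i n)]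
  have hcausal : IsCausal v := .of_directed hinj hw hv hs fun n =>
    (U n).isPlay.isCausal (U n).closed
  have hclosed : IsClosedWorld L := by
    constructor
    · intro n j x
      obtain ⟨N, x, rfl⟩ := hs _ x
      obtain ⟨m, j', y, rfl⟩ := (U N).closed.out n j x
      exact ⟨m, j', (κ N).app _ y, (app_res (κ N) _ y).symm⟩
    · intro n j x
      obtain ⟨N, x, rfl⟩ := hs _ x
      obtain ⟨m, j', y, rfl⟩ := (U N).closed.inp n j x
      exact ⟨m, j', (κ N).app _ y, (app_res (κ N) _ y).symm⟩
  have hκ : ∀ n, Mono (κ n) := fun n => by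
    have := fun c => (mono_iff_injective ((κ n).app c)).2 (hinj n c)
    exact NatTrans.mono_of_mono_app (κ n)
  exact ⟨⟨L, v, hcausal.isPlay hX, hclosed⟩, fun n => ⟨κ n, hκ n, hv n⟩,
    fun n => ClosedPlay.Hom.ext (hw n), hs⟩

section

variable {X : Diagram} {U : ℕ → ClosedPlay X} {i : ∀ n, U n ⟶ U (n + 1)} {L : ClosedPlay X}
  {ι : ∀ n, U n ⟶ L}

theorem IsUnion.range_mono (h : IsUnion U i L ι) {n m : ℕ} (hnm : n ≤ m) (c : Objᵒᵖ) :
    Set.range ((ClosedPlay.Hom.k (ι n)).app c) ⊆ Set.range ((ClosedPlay.Hom.k (ι m)).app c) := by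
  induction m, hnm using Nat.le_induction with
  | base => exact subset_rfl
  | succ m _ ih =>
    refine ih.trans ?_
    rintro _ ⟨x, rfl⟩
    rw [← h.w m]
    exact ⟨(ClosedPlay.Hom.k (i m)).app c x, rfl⟩

/-- Views of the union are views of one of the plays. -/
theorem IsUnion.exists_factor (h : IsUnion U i L ι) {V : PlayOn X} (hV : IsView V.emb)
    (g : V ⟶ (ClosedPlay.incl X).obj L) :
    ∃ n, ∃ g' : V ⟶ (ClosedPlay.incl X).obj (U n), g' ≫ (ClosedPlay.incl X).map (ι n) = g := by
  have : Finite (Σ c, V.total.obj (op c)) := hV.isFiniteDiagram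
  let k : V.total ⟶ L.total := PlayOn.Hom.k g
  have hk : Mono k := PlayOn.Hom.mono_k g
  choose N y hy using fun x : Σ c, V.total.obj (op c) => h.cover _ (k.app (op x.1) x.2)
  obtain ⟨n, hn⟩ := Finite.exists_le N
  have hι := ClosedPlay.Hom.mono_k (ι n)
  obtain ⟨k', hk'⟩ := CCS.exists_factor k (ClosedPlay.Hom.k (ι n)) fun c x =>
    h.range_mono (hn ⟨c, x⟩) (op c) ⟨_, hy ⟨c, x⟩⟩
  have hmono : Mono k' := by
    rw [← hk'] at hk
    exact mono_of_mono k' (ClosedPlay.Hom.k (ι n))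
  let b : V.base ⟶ X := PlayOn.Hom.h g
  have square : b ≫ L.emb = V.emb ≫ k := PlayOn.Hom.square g
  refine ⟨n, ⟨b, k', PlayOn.Hom.mono_h g, hmono, ?_, PlayOn.Hom.triangle g⟩,
    PlayOn.Hom.ext (Category.comp_id _) hk'⟩
  change b ≫ (U n).emb = V.emb ≫ k'
  rw [← cancel_mono (ClosedPlay.Hom.k (ι n)), Category.assoc, Category.assoc, hk', ← square]
  exact congrArg _ (ClosedPlay.Hom.triangle (ι n))

theorem incl_cancel {U V : ClosedPlay X} (i : U ⟶ V) {W : PlayOn X}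
    {g g' : W ⟶ (ClosedPlay.incl X).obj U}
    (h : g ≫ (ClosedPlay.incl X).map i = g' ≫ (ClosedPlay.incl X).map i) : g = g' := by
  have := ClosedPlay.Hom.mono_k i
  refine PlayOn.Hom.ext ?_ ?_
  · have := congrArg PlayOn.Hom.h h
    exact (Category.comp_id _).symm.trans (this.trans (Category.comp_id _))
  · have := congrArg PlayOn.Hom.k h
    exact (cancel_mono (ClosedPlay.Hom.k i)).1 this

end

/-! ### Gluing states -/

section

variable {X : Diagram} {F : Strategy.{w} X}

/-- The component of a state at a view of its underlying play. -/
noncomputable def component {U : ClosedPlay X} (σ : (Gl F).obj (op U)) (V : ViewOn X)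
    (g : V.obj ⟶ (ClosedPlay.incl X).obj U) : (F ⋙ uliftFunctor.{1, w}).obj (op V) :=
  limit.π (StructuredArrow.proj (op ((ClosedPlay.incl X).obj U)) (isViewOn X).ι.op ⋙
    F ⋙ uliftFunctor.{1, w}) (StructuredArrow.mk (T := (isViewOn X).ι.op) (Y := op V) g.op) σ

theorem component_map {U U' : ClosedPlay X} (i : U ⟶ U') (σ : (Gl F).obj (op U')) (V : ViewOn X)
    (g : V.obj ⟶ (ClosedPlay.incl X).obj U) :
    component ((Gl F).map i.op σ) V g = component σ V (g ≫ (ClosedPlay.incl X).map i) := by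
  let L := (isViewOn X).ι.op
  let f : op ((ClosedPlay.incl X).obj U') ⟶ op ((ClosedPlay.incl X).obj U) :=
    ((ClosedPlay.incl X).map i).op
  have e : (L.pointwiseRightKanExtension (F ⋙ uliftFunctor.{1, w})).map f ≫
      limit.π (StructuredArrow.proj _ L ⋙ F ⋙ uliftFunctor.{1, w})
        (StructuredArrow.mk (T := L) (Y := op V) g.op) =
      limit.π (StructuredArrow.proj _ L ⋙ F ⋙ uliftFunctor.{1, w})
        (StructuredArrow.mk (T := L) (Y := op V) (f ≫ g.op)) := by
    rw [Functor.pointwiseRightKanExtension_map]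
    exact limit.lift_π _ _
  exact ConcreteCategory.congr_hom e σ

theorem component_comp {U : ClosedPlay X} (σ : (Gl F).obj (op U)) {V W : ViewOn X} (f : W ⟶ V)
    (g : V.obj ⟶ (ClosedPlay.incl X).obj U) :
    component σ W ((isViewOn X).ι.map f ≫ g) =
      (F ⋙ uliftFunctor.{1, w}).map f.op (component σ V g) :=
  (ConcreteCategory.congr_hom (limit.w (StructuredArrow.proj
    (op ((ClosedPlay.incl X).obj U)) (isViewOn X).ι.op ⋙ F ⋙ uliftFunctor.{1, w})
    (StructuredArrow.homMk (f := StructuredArrow.mk (T := (isViewOn X).ι.op) (Y := op V) g.op)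
      (f' := StructuredArrow.mk (T := (isViewOn X).ι.op) (Y := op W)
        ((isViewOn X).ι.map f ≫ g).op) f.op rfl)) σ).symm

theorem state_ext {U : ClosedPlay X} {σ σ' : (Gl F).obj (op U)}
    (h : ∀ V g, component σ V g = component σ' V g) : σ = σ' := by
  have : (↾fun _ : PUnit => σ) = ↾fun _ => σ' := limit.hom_ext fun j => by
    ext
    exact h j.right.unop j.hom.unop
  exact ConcreteCategory.congr_hom this PUnit.unit

/-- States are families of components compatible with restriction along morphisms of views. -/
theorem exists_state {U : ClosedPlay X}
    (t : ∀ V : ViewOn X, (V.obj ⟶ (ClosedPlay.incl X).obj U) →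
      (F ⋙ uliftFunctor.{1, w}).obj (op V))
    (ht : ∀ {V W : ViewOn X} (f : W ⟶ V) (g : V.obj ⟶ (ClosedPlay.incl X).obj U),
      t W ((isViewOn X).ι.map f ≫ g) = (F ⋙ uliftFunctor.{1, w}).map f.op (t V g)) :
    ∃ σ : (Gl F).obj (op U), ∀ V g, component σ V g = t V g := by
  let s : Cone (StructuredArrow.proj (op ((ClosedPlay.incl X).obj U)) (isViewOn X).ι.op ⋙
      F ⋙ uliftFunctor.{1, w}) :=
    { pt := PUnit
      π :=
        { app := fun j => ↾fun _ => t j.right.unop j.hom.unop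
          naturality := fun j j' f => by
            ext
            have := ht f.right.unop j.hom.unop
            have hw : j'.hom.unop = (isViewOn X).ι.map f.right.unop ≫ j.hom.unop :=
              congrArg Quiver.Hom.unop (StructuredArrow.w f).symm
            rw [← hw] at this
            exact this } }
  refine ⟨limit.lift _ s PUnit.unit, fun V g => ?_⟩
  exact ConcreteCategory.congr_hom (limit.lift_π s (StructuredArrow.mk (T := (isViewOn X).ι.op)
    (Y := op V) g.op)) PUnit.unit

/-- Compatible states on an increasing sequence of plays glue to a state on their union, because
every view of the union, being finite, is a view of some term of the sequence. -/
theorem IsUnion.exists_state {U : ℕ → ClosedPlay X} {i : ∀ n, U n ⟶ U (n + 1)} {L : ClosedPlay X}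
    {ι : ∀ n, U n ⟶ L} (h : IsUnion U i L ι) (σ : ∀ n, (Gl F).obj (op (U n)))
    (hσ : ∀ n, (Gl F).map (i n).op (σ (n + 1)) = σ n) :
    ∃ τ : (Gl F).obj (op L), ∀ n, (Gl F).map (ι n).op τ = σ n := by
  -- The component at a view of the union does not depend on the term it is factored through.
  have le : ∀ (V : ViewOn X) (n m : ℕ) (_ : n ≤ m) (g : V.obj ⟶ (ClosedPlay.incl X).obj (U n))
      (g' : V.obj ⟶ (ClosedPlay.incl X).obj (U m)),
      g ≫ (ClosedPlay.incl X).map (ι n) = g' ≫ (ClosedPlay.incl X).map (ι m) →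
      component (σ n) V g = component (σ m) V g' := by
    intro V n m hnm g
    induction m, hnm using Nat.le_induction with
    | base => exact fun g' hg => congrArg _ (incl_cancel (ι n) hg)
    | succ m hnm ih =>
      intro g' hg
      have step : ∀ (g₁ : V.obj ⟶ (ClosedPlay.incl X).obj (U m)),
          g₁ ≫ (ClosedPlay.incl X).map (ι m) = g' ≫ (ClosedPlay.incl X).map (ι (m + 1)) →
          component (σ m) V g₁ = component (σ (m + 1)) V g' := by
        intro g₁ hg₁
        rw [← hσ m, component_map]
        refine congrArg _ (incl_cancel (ι (m + 1)) ?_)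
        rw [Category.assoc, ← Functor.map_comp, h.w, hg₁]
      obtain ⟨g₁, hg₁⟩ : ∃ g₁ : V.obj ⟶ (ClosedPlay.incl X).obj (U m),
          g₁ ≫ (ClosedPlay.incl X).map (ι m) = g ≫ (ClosedPlay.incl X).map (ι n) := by
        clear ih hg step g'
        induction m, hnm using Nat.le_induction with
        | base => exact ⟨g, rfl⟩
        | succ m hnm ih =>
          obtain ⟨g₁, hg₁⟩ := ih
          refine ⟨g₁ ≫ (ClosedPlay.incl X).map (i m), ?_⟩
          rw [Category.assoc, ← Functor.map_comp, h.w, hg₁]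
      rw [ih g₁ hg₁.symm, step g₁ (hg₁.trans hg)]
  have eq : ∀ (V : ViewOn X) (n m : ℕ) (g : V.obj ⟶ (ClosedPlay.incl X).obj (U n))
      (g' : V.obj ⟶ (ClosedPlay.incl X).obj (U m)),
      g ≫ (ClosedPlay.incl X).map (ι n) = g' ≫ (ClosedPlay.incl X).map (ι m) →
      component (σ n) V g = component (σ m) V g' := by
    intro V n m g g' hg
    obtain hnm | hnm := le_total n m
    · exact le V n m hnm g g' hg
    · exact (le V m n hnm g' g hg.symm).symm
  choose N k hk using fun (V : ViewOn X) (g : V.obj ⟶ (ClosedPlay.incl X).obj L) =>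
    h.exists_factor V.property g
  obtain ⟨τ, hτ⟩ := CCS.exists_state (F := F) (fun V g => component (σ (N V g)) V (k V g)) (by
    intro V W f g
    rw [← component_comp]
    refine eq W _ _ _ _ ?_
    rw [hk, Category.assoc, hk])
  refine ⟨τ, fun n => state_ext fun V g => ?_⟩
  rw [component_map, hτ]
  exact eq V _ _ _ _ (hk V _)

end

/-! ### Maximal extensions -/

section

variable {X : Diagram}

/-- The play `U` contains an element with causal history `a`. -/
def ClosedPlay.Covers (U : ClosedPlay X) (a : History X) : Prop :=
  (History.elements U.emb a.1 a.2).Nonempty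

/-- A greedy step: the causal history `a` is added to the play if some extension of the state
contains it. -/
theorem exists_greedy (G : Behaviour.{w} X) (s : Σ U : ClosedPlay X, G.obj (op U))
    (a : Option (History X)) :
    ∃ (s' : Σ U : ClosedPlay X, G.obj (op U)) (i : s.1 ⟶ s'.1), IsExtension G i s.2 s'.2 ∧
      ∀ b ∈ a, ∀ (V : ClosedPlay X) (j : s.1 ⟶ V) (τ : G.obj (op V)), IsExtension G j s.2 τ →
        V.Covers b → s'.1.Covers b := by
  by_cases h : ∃ b ∈ a, ∃ (V : ClosedPlay X) (j : s.1 ⟶ V) (τ : G.obj (op V)),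
      IsExtension G j s.2 τ ∧ V.Covers b
  · obtain ⟨b, hb, V, j, τ, hτ, hV⟩ := h
    refine ⟨⟨V, τ⟩, j, hτ, fun b' hb' _ _ _ _ _ => ?_⟩
    cases Option.mem_unique hb hb'
    exact hV
  · refine ⟨s, 𝟙 _, by simp [IsExtension], fun b hb V j τ hτ hV => ?_⟩
    exact (h ⟨b, hb, V, j, τ, hτ, hV⟩).elim

end

end CCS

theorem mainTheorem2 (X : CCS.Diagram) (hX : CCS.IsPosition X) (F : CCS.Strategy.{w} X)
    (U : CCS.ClosedPlay X) (hU : U.IsFinite) (σ : (CCS.Gl F).obj (Opposite.op U)) :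
    ∃ (U' : CCS.ClosedPlay X) (i : U ⟶ U') (σ' : (CCS.Gl F).obj (Opposite.op U')),
      CCS.IsExtension (CCS.Gl F) i σ σ' ∧ CCS.IsMaximalState (CCS.Gl F) σ' := by
  have := CCS.countable_history hX
  obtain ⟨a, ha⟩ := exists_surjective_nat (Option (CCS.History X))
  choose next i hi hnext using fun (s : Σ U : CCS.ClosedPlay X, (CCS.Gl F).obj (op U)) n =>
    CCS.exists_greedy (CCS.Gl F) s (a n)
  let s : ℕ → Σ U : CCS.ClosedPlay X, (CCS.Gl F).obj (op U) := fun n =>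
    Nat.rec ⟨U, σ⟩ (fun n s => next s n) n
  obtain ⟨L, ι, hL⟩ := CCS.exists_isUnion hX (fun n => (s n).1) (fun n => i (s n) n)
  obtain ⟨τ, hτ⟩ := hL.exists_state (fun n => (s n).2) (fun n => hi (s n) n)
  refine ⟨L, ι 0, τ, hτ 0, fun V j ρ hρ hstrict => hstrict fun c y => ?_⟩
  -- It remains to show that an arbitrary element `y` of the extension `V` lies in `L`.
  have hV := V.isPlay.isCausal V.closed
  obtain ⟨b, hb⟩ := (hV.reached y).exists_history
  obtain ⟨n, hn⟩ := ha (some b)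
  -- The extension `V` of the `n`-th state contains `b`, hence so does the next state.
  obtain ⟨⟨d, x⟩, hx⟩ := hnext (s n) n b hn V (ι n ≫ j) ρ
    (by
      change (CCS.Gl F).map (ι n ≫ j).op ρ = _
      rw [← hτ n, ← (show (CCS.Gl F).map j.op ρ = τ from hρ)]
      simp) ⟨_, hb⟩
  have := CCS.History.elements_map (CCS.ClosedPlay.Hom.k (ι (n + 1) ≫ j)) b.1 b.2 hx
  rw [CCS.ClosedPlay.Hom.triangle (ι (n + 1) ≫ j)] at this
  have := hV.subsingleton_elements _ _ this hb
  obtain ⟨rfl, h⟩ := Sigma.mk.inj this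
  exact ⟨(CCS.ClosedPlay.Hom.k (ι (n + 1))).app _ x, eq_of_heq h⟩
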